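/- Let $n\ge 0$ and let $w=w_1w_2\cdots w_n\in S_n$ be a permutation of $\{1,\dots,n\}$. Write $s_a$ for the simple transposition $(a\ a{+}1)$, $t_{i,j}$ for the transposition $(i\ j)$ (so that $wt_{i,j}$ is obtained from $w$ by swapping $w_i$ and $w_j$), and $\ell(w)$ for the length of $w$, i.e. the least number of simple transpositions in a decomposition of $w$. A reduced word of $w$ is a sequence $(a_1,\dots,a_\ell)$ with $\ell=\ell(w)$ and $w=s_{a_1}\cdots s_{a_\ell}$. The Stanley symmetric function of $w$ is \[F_w(x)=\sum_{(a_1,\dots,a_\ell)}\ \sum_{\substack{1\le b_1\le\cdots\le b_\ell\\ a_i<a_{i+1}\Rightarrow b_i<b_{i+1}}}x_{b_1}\cdots x_{b_\ell},\] where $(a_1,\dots,a_\ell)$ ranges over the reduced words of $w$. The Edelman–Greene coefficients $c^w_\lambda$ of $w$ are the coefficients of the expansion $F_w=\sum_\lambda c^w_\lambda s_\lambda$ in the basis of Schur functions. The permutation $w$ is dominant if it avoids the pattern $132$, i.e. there are no $i<t<j$ with $w_i<w_j<w_t$. The Lehmer code of $w$ is $(c_1,\dots,c_n)$ with $c_i=|\{j>i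 : w_j<w_i\}|$. If $w$ is not dominant, put \[p=\max\{t : \exists\, i<t<j,\ w_i<w_j<w_t\},\qquad q=\max\{j>p : w_j<w_p,\ \exists\, i<p,\ w_i<w_j\},\] and, with $u=wt_{p,q}$, let the children of $w$ be the permutations $ut_{i,p}$, where $i<p$ and $\ell(ut_{i,p})=\ell(u)+1$. The modified Lascoux–Schützenberger tree (modified LS-tree) of $w$ is the finite rooted tree, with nodes labelled by elements of $S_n$, obtained by starting with a root labelled $w$ and repeatedly attaching to every node with a non-dominant label one child for each child of this label; nodes with a dominant label have no children. Theorem. Every leaf of the modified LS-tree of $w$ is labelled by a dominant permutation. There is exactly one finitely supported family of integers $(c^w_\lambda)_\lambda$, indexed by partitions, with $F_w=\sum_\lambda c^w_\lambda s_\lambda$, and for every partition $\lambda$ the Edelman–Greene coefficient $c^w_\lambda$ equals the number of leaves of the modified LS-tree of $w$ whose labels are dominant permutations with Lehmer code $\lambda$ (up to trailing zeros). -/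

import Mathlib

namespace ModifiedLS

open Equiv

/-! Permutations of `{1, …, n}` are elements of `Perm (Fin n)`: positions, values, letters of words
and the indices of the variables are all shifted down by one. The one-line notation of `w` is
`w 0, w 1, …, w (n - 1)`, and `w * swap i j` exchanges the entries of `w` in positions `i`, `j`. -/

/-! ### Reduced words and length -/

/-- The simple transposition exchanging the consecutive elements `a` and `a + 1`. -/
def simpleTransposition {n : ℕ} (a : Fin (n - 1)) : Perm (Fin n) :=
  swap ⟨a, by omega⟩ ⟨a + 1, by omega⟩

/-- The product of the simple transpositions indexed by the letters of a word. -/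
def wordProd {n : ℕ} (a : List (Fin (n - 1))) : Perm (Fin n) :=
  (a.map simpleTransposition).prod

/-- The length of `w`: the least number of simple transpositions in a decomposition of `w`. -/
noncomputable def length {n : ℕ} (w : Perm (Fin n)) : ℕ :=
  sInf {l : ℕ | ∃ a : List (Fin (n - 1)), wordProd a = w ∧ a.length = l}

/-- `a` is a reduced word of `w`. -/
def IsReducedWord {n : ℕ} (w : Perm (Fin n)) (a : List (Fin (n - 1))) : Prop :=
  wordProd a = w ∧ a.length = length w

theorem exists_wordProd_eq {n : ℕ} (w : Perm (Fin n)) :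
    ∃ a : List (Fin (n - 1)), wordProd a = w := by
  rcases n with _ | n
  · exact ⟨[], Subsingleton.elim _ _⟩
  · have hw : w ∈ Submonoid.closure
        (Set.range fun i : Fin n ↦ swap i.castSucc i.succ) := by
      rw [Perm.mclosure_swap_castSucc_succ]; trivial
    induction hw using Submonoid.closure_induction with
    | mem x hx =>
      obtain ⟨i, rfl⟩ := hx
      exact ⟨[i], by simp [wordProd, simpleTransposition]; rfl⟩
    | one => exact ⟨[], rfl⟩
    | mul x y _ _ hx hy =>
      obtain ⟨a, rfl⟩ := hx
      obtain ⟨b, rfl⟩ := hy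
      exact ⟨a ++ b, by simp [wordProd]⟩

theorem exists_word_length_eq {n : ℕ} (w : Perm (Fin n)) :
    ∃ a : List (Fin (n - 1)), wordProd a = w ∧ a.length = length w := by
  obtain ⟨a, ha⟩ := exists_wordProd_eq w
  exact Nat.sInf_mem (s := {l : ℕ | ∃ a : List (Fin (n - 1)), wordProd a = w ∧ a.length = l})
    ⟨_, a, ha, rfl⟩

theorem length_le_of_word {n : ℕ} (a : List (Fin (n - 1))) : length (wordProd a) ≤ a.length :=
  Nat.sInf_le ⟨a, rfl, rfl⟩

theorem exists_shorter_word {n : ℕ} (i k : Fin n) (hik : i < k) (a : List (Fin (n - 1))) :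
    wordProd a k < wordProd a i →
      ∃ b, wordProd b = wordProd a * swap i k ∧ b.length + 1 = a.length := by
  induction a with
  | nil => intro h; simp [wordProd] at h; exact absurd h (not_lt.mpr hik.le)
  | cons c a ih =>
    intro h
    have hc : wordProd (c :: a) = simpleTransposition c * wordProd a := by simp [wordProd]
    by_cases hv : wordProd a k < wordProd a i
    · obtain ⟨b, hb, hl⟩ := ih hv
      refine ⟨c :: b, ?_, by simp [hl]⟩
      rw [hc, mul_assoc, ← hb]; simp [wordProd]
    · have hne : wordProd a i ≠ wordProd a k := fun e => hik.ne ((wordProd a).injective e)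
      have hlt : wordProd a i < wordProd a k := lt_of_le_of_ne (not_lt.mp hv) hne
      refine ⟨a, ?_, by simp⟩
      have key : simpleTransposition c = swap (wordProd a i) (wordProd a k) := by
        rw [hc] at h
        simp only [Perm.mul_apply, simpleTransposition] at h ⊢
        generalize wordProd a i = x at *
        generalize wordProd a k = y at *
        have : x = ⟨c, by omega⟩ ∧ y = ⟨c + 1, by omega⟩ := by
          simp only [swap_apply_def] at h
          simp only [Fin.ext_iff, Fin.lt_def] at *
          split_ifs at h <;> simp_all <;> omega
        rw [this.1, this.2]
      rw [hc, key, mul_assoc, mul_swap_eq_swap_mul, ← mul_assoc, swap_mul_self, one_mul]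

theorem length_mul_swap_lt {n : ℕ} (u : Perm (Fin n)) {i k : Fin n} (hik : i < k)
    (h : u k < u i) : length (u * swap i k) < length u := by
  obtain ⟨a, rfl, ha⟩ := exists_word_length_eq u
  obtain ⟨b, hb, hl⟩ := exists_shorter_word i k hik a h
  have := length_le_of_word b
  rw [hb] at this
  omega

/-! ### Stanley symmetric functions and Schur functions

Both are formal power series with integer coefficients in the variables `x 0, x 1, x 2, …`. -/

/-- The index set of the double sum defining the Stanley symmetric function of `w`: lists of pairs
`(a₁, b₁), …, (aₗ, bₗ)` such that `a₁, …, aₗ` is a reduced word of `w`, the sequence `b` is weakly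
increasing, and `aᵢ < aᵢ₊₁` implies `bᵢ < bᵢ₊₁`. -/
def stanleyIndex {n : ℕ} (w : Perm (Fin n)) : Set (List (Fin (n - 1) × ℕ)) :=
  {L | IsReducedWord w (L.map Prod.fst) ∧
    L.IsChain (fun x y => x.2 ≤ y.2 ∧ (x.1 < y.1 → x.2 < y.2))}

/-- The Stanley symmetric function `F_w`: the coefficient of a monomial `x ^ d` is the number of
elements `(a₁, b₁), …, (aₗ, bₗ)` of the index set with `x_{b₁} ⋯ x_{bₗ} = x ^ d`. -/
noncomputable def stanley {n : ℕ} (w : Perm (Fin n)) : MvPowerSeries ℕ ℤ :=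
  fun d => (Set.ncard {L ∈ stanleyIndex w | (L.map fun x => Finsupp.single x.2 1).sum = d} : ℤ)

/-- The Schur function `s_μ`: the coefficient of `x ^ d` is the number of semistandard Young
tableaux of shape `μ` whose content is `d`. -/
noncomputable def schur (μ : YoungDiagram) : MvPowerSeries ℕ ℤ :=
  fun d => (Set.ncard {T : SemistandardYoungTableau μ |
    ∑ x ∈ μ.cells, Finsupp.single (T x.1 x.2) 1 = d} : ℤ)

/-- `c` is the family of Edelman–Greene coefficients of `w`, that is, `F_w = ∑ μ, c μ • s_μ`. -/
def IsEdelmanGreeneCoeff {n : ℕ} (w : Perm (Fin n)) (c : YoungDiagram →₀ ℤ) : Prop :=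
  stanley w = c.sum fun μ m => m • schur μ

/-! ### Dominant permutations and Lehmer codes -/

/-- A permutation is dominant if it avoids the pattern 132. -/
def IsDominant {n : ℕ} (w : Perm (Fin n)) : Prop :=
  ¬ ∃ i t j : Fin n, i < t ∧ t < j ∧ w i < w j ∧ w j < w t

/-- The Lehmer code of `w`. -/
def lehmerCode {n : ℕ} (w : Perm (Fin n)) (i : Fin n) : ℕ :=
  (Finset.univ.filter fun j : Fin n => i < j ∧ w j < w i).card

/-- The Lehmer code of `w` is the partition `μ` (padded with zeros). -/
def HasLehmerCode {n : ℕ} (w : Perm (Fin n)) (μ : YoungDiagram) : Prop :=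
  ∀ i : ℕ, μ.rowLen i = if h : i < n then lehmerCode w ⟨i, h⟩ else 0

/-! ### The modified Lascoux–Schützenberger tree -/

/-- The positions `t` that carry the largest entry of an occurrence of the pattern 132 in `w`. -/
def peakPositions {n : ℕ} (w : Perm (Fin n)) : Finset (Fin n) :=
  Finset.univ.filter fun t => ∃ i j : Fin n, i < t ∧ t < j ∧ w i < w j ∧ w j < w t

theorem peakPositions_nonempty {n : ℕ} {w : Perm (Fin n)} (h : ¬ IsDominant w) :
    (peakPositions w).Nonempty := by
  obtain ⟨i, t, j, h⟩ := not_not.mp h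
  exact ⟨t, by simpa [peakPositions] using ⟨i, h.1, j, h.2⟩⟩

/-- The index `p` of a non-dominant permutation. -/
def pIndex {n : ℕ} (w : Perm (Fin n)) (h : ¬ IsDominant w) : Fin n :=
  (peakPositions w).max' (peakPositions_nonempty h)

/-- The positions `j > p` with `w j < w p` such that `w i < w j` for some `i < p`. -/
def qCandidates {n : ℕ} (w : Perm (Fin n)) (p : Fin n) : Finset (Fin n) :=
  Finset.univ.filter fun j => p < j ∧ w j < w p ∧ ∃ i, i < p ∧ w i < w j

theorem qCandidates_nonempty {n : ℕ} {w : Perm (Fin n)} (h : ¬ IsDominant w) :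
    (qCandidates w (pIndex w h)).Nonempty := by
  have hp : pIndex w h ∈ peakPositions w := Finset.max'_mem _ _
  obtain ⟨i, j, h1, h2, h3, h4⟩ := (Finset.mem_filter.mp hp).2
  exact ⟨j, by simpa [qCandidates] using ⟨h2, h4, i, h1, h3⟩⟩

/-- The index `q` of a non-dominant permutation. -/
def qIndex {n : ℕ} (w : Perm (Fin n)) (h : ¬ IsDominant w) : Fin n :=
  (qCandidates w (pIndex w h)).max' (qCandidates_nonempty h)

/-- `I(u, k) = {i < k | ℓ(u t_{i,k}) = ℓ(u) + 1}`. -/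
noncomputable def leftCovers {n : ℕ} (u : Perm (Fin n)) (k : Fin n) : Finset (Fin n) :=
  Finset.univ.filter fun i => i < k ∧ length (u * swap i k) = length u + 1

/-- `Φ(u, k) = {u t_{i,k} | i ∈ I(u, k)}`. -/
noncomputable def transitions {n : ℕ} (u : Perm (Fin n)) (k : Fin n) : Finset (Perm (Fin n)) :=
  (leftCovers u k).image fun i => u * swap i k

open Classical in
/-- The labels of the children of a node labelled `w` in a modified LS-tree: none if `w` is
dominant, and `Φ(w t_{p,q}, p)` otherwise. -/
noncomputable def childLabels {n : ℕ} (w : Perm (Fin n)) : Finset (Perm (Fin n)) :=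
  if h : IsDominant w then ∅
  else transitions (w * swap (pIndex w h) (qIndex w h)) (pIndex w h)

theorem lex_lt_of_mem_childLabels {n : ℕ} {w v : Perm (Fin n)} (hv : v ∈ childLabels w) :
    toLex (w : Fin n → Fin n) < toLex (v : Fin n → Fin n) := by
  unfold childLabels at hv
  split_ifs at hv with h
  · simp at hv
  · have hq : qIndex w h ∈ qCandidates w (pIndex w h) := Finset.max'_mem _ _
    obtain ⟨hpq, -, -⟩ := (Finset.mem_filter.mp hq).2
    obtain ⟨i, hi, rfl⟩ := Finset.mem_image.mp hv
    obtain ⟨hip, hl⟩ := (Finset.mem_filter.mp hi).2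
    generalize pIndex w h = p at *
    generalize qIndex w h = q at *
    have hle : ¬ (w * swap p q) p < (w * swap p q) i := fun hlt => by
      have := length_mul_swap_lt _ hip hlt
      omega
    have hne : (w * swap p q) i ≠ (w * swap p q) p := fun e =>
      hip.ne ((w * swap p q).injective e)
    have hiq : i ≠ q := (hip.trans hpq).ne
    have hlt := lt_of_le_of_ne (not_lt.mp hle) hne
    refine ⟨i, fun j hj => ?_, ?_⟩
    · have h1 : j ≠ p := (hj.trans hip).ne
      have h2 : j ≠ q := (hj.trans (hip.trans hpq)).ne
      simp [swap_apply_of_ne_of_ne hj.ne h1, swap_apply_of_ne_of_ne h1 h2]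
    · simpa [Perm.mul_apply, swap_apply_of_ne_of_ne hip.ne hiq] using hlt

/-- Finite rooted trees whose nodes are labelled by elements of `α`, the children of each node being
indexed by a finite subset of `α`. -/
inductive LabelledTree (α : Type) : Type
  | node (label : α) (S : Finset α) (child : S → LabelledTree α) : LabelledTree α

open Classical in
/-- The multiset of the labels of the leaves (the nodes without children), one for each leaf. -/
noncomputable def LabelledTree.leaves {α : Type} : LabelledTree α → Multiset α
  | .node a S child => if S = ∅ then {a} else ∑ v : S, (child v).leaves

/-- The modified Lascoux–Schützenberger tree of `w`: the root is labelled `w`, and for every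
`v ∈ childLabels w` there is one child of the root, which is the root of the modified LS-tree
of `v`. -/
noncomputable def modifiedLSTree {n : ℕ} (w : Perm (Fin n)) : LabelledTree (Perm (Fin n)) :=
  .node w (childLabels w) fun v => modifiedLSTree v.1
termination_by (wellFounded_gt (α := Lex (Fin n → Fin n))).wrap (toLex (w : Fin n → Fin n))
decreasing_by exact lex_lt_of_mem_childLabels v.2

open Classical in
/-- The number of leaves of the modified LS-tree of `w` whose labels are dominant permutations with
Lehmer code `μ`. -/
noncomputable def leafCount {n : ℕ} (w : Perm (Fin n)) (μ : YoungDiagram) : ℕ :=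
  (modifiedLSTree w).leaves.countP fun v => IsDominant v ∧ HasLehmerCode v μ

end ModifiedLS

/-! In the nilCoxeter algebra with generators `u_a`, the part of `F_w` in finitely many variables is
the coefficient of `w` in the product, over the variables `x_b` in order, of the factors `(1 + x_b
u_{N-1}) ⋯ (1 + x_b u_0)`. For an arbitrary list of pairs (letter, variable) this coefficient is
`redPoly`; `stanley_apply` makes the link with `F_w`.

The tree is governed by a transition formula: if the entry of `u` in position `k` has a smaller
entry to its left and a larger one to its right, then the sum of `F_{u t_{i,k}}` over the covers
with `i < k` equals the sum of `F_{u t_{k,j}}` over the covers with `j > k`. The difference of the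
two sums is the operator `monk k`. It commutes with `leftOp` up to a correction depending only on
the value `u k` (`monk_leftOp`), and these corrections telescope along the letters of one variable
(`monk_redPoly_block`, `monk_redPoly_blocks`). The choice of `p` and `q` makes `w` the only cover of
`w t_{p,q}` of the second kind, so `F_w` is the sum of the Stanley functions of the children of `w`,
and hence of the labels of the leaves (`stanley_eq_sum_leaves`).

It remains to see that `F_v = s_μ` for `v` dominant with code `μ`. An inverse Grassmannian
permutation `g` of shape `μ` has `F_g = s_μ`, because both sides obey the same recursion when a
largest pair is appended to the list (`redPoly_eq_tableauPoly`). Moreover `g` is vexillary, and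
below a vexillary permutation the tree does not branch and only permutes the entries of the code
(`IsVexillary.exists_childLabels_eq`). The single leaf below `g` is thus a dominant permutation with
code `μ`, and a permutation is determined by its code: up to fixed points the leaf is `v`.

Uniqueness of the coefficients is the unitriangularity of the Schur functions with respect to
dominance order. -/

namespace ModifiedLS

open Equiv

variable {n : ℕ}

/-! ### Descents, covers and length -/

/-- The simple transposition exchanging `a` and `a + 1`, or `1` if these are not both below `n`. -/
def adjSwap (n a : ℕ) : Perm (Fin n) :=
  if h : a + 1 < n then swap ⟨a, by omega⟩ ⟨a + 1, h⟩ else 1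

/-- The value `a + 1` stands to the left of the value `a` in the one-line notation of `w`. -/
def LeftDescent (w : Perm (Fin n)) (a : ℕ) : Prop :=
  ∃ h : a + 1 < n, w.symm ⟨a + 1, h⟩ < w.symm ⟨a, by omega⟩

/-- The entry in position `a` is larger than the entry in position `a + 1`. -/
def RightDescent (w : Perm (Fin n)) (a : ℕ) : Prop :=
  ∃ h : a + 1 < n, w ⟨a + 1, h⟩ < w ⟨a, by omega⟩

/-- Exchanging the entries in positions `i < k` goes up in the Bruhat order by a cover. -/
def Cover (u : Perm (Fin n)) (i k : Fin n) : Prop :=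
  i < k ∧ u i < u k ∧ ∀ m, i < m → m < k → u i < u m → u k < u m

theorem adjSwap_mul_self (n a : ℕ) : adjSwap n a * adjSwap n a = 1 := by
  unfold adjSwap; split_ifs <;> simp

theorem adjSwap_inv (n a : ℕ) : (adjSwap n a)⁻¹ = adjSwap n a := by
  unfold adjSwap; split_ifs <;> simp

theorem adjSwap_symm (n a : ℕ) : (adjSwap n a).symm = adjSwap n a := adjSwap_inv n a

theorem val_adjSwap {a : ℕ} (h : a + 1 < n) (x : Fin n) :
    (adjSwap n a x : ℕ) = if (x : ℕ) = a then a + 1 else if (x : ℕ) = a + 1 then a else x := by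
  simp only [adjSwap, h, dif_pos, swap_apply_def, Fin.ext_iff]
  split_ifs <;> rfl

theorem simpleTransposition_eq (a : Fin (n - 1)) : simpleTransposition a = adjSwap n a := by
  have : (a : ℕ) + 1 < n := by omega
  simp [adjSwap, this, simpleTransposition]

theorem leftDescent_iff (w : Perm (Fin n)) (a : ℕ) :
    LeftDescent w a ↔ ∃ i j : Fin n, i < j ∧ (w i : ℕ) = a + 1 ∧ (w j : ℕ) = a := by
  constructor
  · rintro ⟨h, hl⟩
    exact ⟨_, _, hl, by simp, by simp⟩
  · rintro ⟨i, j, hij, hi, hj⟩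
    have h : a + 1 < n := hi ▸ (w i).2
    refine ⟨h, ?_⟩
    rw [show (⟨a + 1, h⟩ : Fin n) = w i from Fin.ext hi.symm,
      show (⟨a, by omega⟩ : Fin n) = w j from Fin.ext hj.symm]
    simpa using hij

theorem length_lt_mul_swap (u : Perm (Fin n)) {i k : Fin n} (hik : i < k) (h : u i < u k) :
    length u < length (u * swap i k) := by
  have := length_mul_swap_lt (u * swap i k) hik (by simpa using h)
  simpa [mul_assoc] using this

theorem length_adjSwap_mul_le (w : Perm (Fin n)) (a : ℕ) :
    length (adjSwap n a * w) ≤ length w + 1 := by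
  unfold adjSwap
  split_ifs with h
  · obtain ⟨L, rfl, hl⟩ := exists_word_length_eq w
    have := length_le_of_word ((⟨a, by omega⟩ : Fin (n - 1)) :: L)
    simp only [wordProd, List.map_cons, List.prod_cons, List.length_cons] at this ⊢
    rw [hl] at this
    exact this
  · simp

theorem length_mul_adjSwap_le (w : Perm (Fin n)) (a : ℕ) :
    length (w * adjSwap n a) ≤ length w + 1 := by
  unfold adjSwap
  split_ifs with h
  · obtain ⟨L, rfl, hl⟩ := exists_word_length_eq w
    have := length_le_of_word (L ++ [(⟨a, by omega⟩ : Fin (n - 1))])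
    simp only [wordProd, List.map_append, List.prod_append, List.length_append] at this ⊢
    rw [hl] at this
    simpa [simpleTransposition, wordProd] using this
  · simp

theorem RightDescent.length_eq {w : Perm (Fin n)} {a : ℕ} (h : RightDescent w a) :
    length w = length (w * adjSwap n a) + 1 := by
  obtain ⟨h1, h2⟩ := h
  have hlt := length_mul_swap_lt w (i := ⟨a, by omega⟩) (k := ⟨a + 1, h1⟩)
    (Fin.mk_lt_mk.mpr (Nat.lt_succ_self a)) h2
  have hle := length_mul_adjSwap_le (w * adjSwap n a) a
  rw [mul_assoc, adjSwap_mul_self, mul_one] at hle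
  simp only [adjSwap, h1, dif_pos] at *
  omega

theorem adjSwap_mul_eq {a : ℕ} (w : Perm (Fin n)) {i j : Fin n}
    (hi : (w i : ℕ) = a + 1) (hj : (w j : ℕ) = a) : adjSwap n a * w = w * swap i j := by
  have h : a + 1 < n := hi ▸ (w i).2
  rw [mul_swap_eq_swap_mul, swap_comm]
  simp only [adjSwap, h, dif_pos]
  congr 1
  congr 1
  · exact Fin.ext hj.symm
  · exact Fin.ext hi.symm

theorem LeftDescent.length_eq {w : Perm (Fin n)} {a : ℕ} (h : LeftDescent w a) :
    length w = length (adjSwap n a * w) + 1 := by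
  obtain ⟨i, j, hij, hi, hj⟩ := (leftDescent_iff w a).mp h
  have hlt := length_mul_swap_lt w hij (by rw [Fin.lt_def]; omega)
  rw [← adjSwap_mul_eq w hi hj] at hlt
  have hle := length_adjSwap_mul_le (adjSwap n a * w) a
  rw [← mul_assoc, adjSwap_mul_self, one_mul] at hle
  omega

theorem leftDescent_adjSwap_mul {w : Perm (Fin n)} {a : ℕ} (h1 : a + 1 < n)
    (h : ¬ LeftDescent w a) : LeftDescent (adjSwap n a * w) a := by
  rw [leftDescent_iff] at h ⊢
  push Not at h
  have hne : w.symm ⟨a, by omega⟩ ≠ w.symm ⟨a + 1, h1⟩ := by simp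
  refine ⟨w.symm ⟨a, by omega⟩, w.symm ⟨a + 1, h1⟩, ?_, ?_, ?_⟩
  · by_contra hlt
    exact h (w.symm ⟨a + 1, h1⟩) (w.symm ⟨a, by omega⟩)
      (lt_of_le_of_ne (not_lt.mp hlt) hne.symm) (by simp) (by simp)
  · simp [val_adjSwap h1]
  · simp [val_adjSwap h1]

theorem leftDescent_iff_length {w : Perm (Fin n)} {a : ℕ} (h1 : a + 1 < n) :
    LeftDescent w a ↔ length w = length (adjSwap n a * w) + 1 := by
  refine ⟨LeftDescent.length_eq, fun h => ?_⟩
  by_contra hd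
  have := (leftDescent_adjSwap_mul h1 hd).length_eq
  rw [← mul_assoc, adjSwap_mul_self, one_mul] at this
  omega

theorem rightDescent_mul_adjSwap {w : Perm (Fin n)} {a : ℕ} (h1 : a + 1 < n)
    (h : ¬ RightDescent w a) : RightDescent (w * adjSwap n a) a := by
  refine ⟨h1, ?_⟩
  have h2 : ¬ w ⟨a + 1, h1⟩ < w ⟨a, by omega⟩ := fun h' => h ⟨h1, h'⟩
  have hne : w ⟨a, by omega⟩ ≠ w ⟨a + 1, h1⟩ := by simp
  simpa [adjSwap, h1] using lt_of_le_of_ne (not_lt.mp h2) hne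

/-- Induction on `k - i`: with `j = k - 1` and `s = t_{j,k}` one has `t_{i,k} = s t_{i,j} s`, and
`t_{i,j}` is a cover of `u s`. Of the two multiplications by `s`, at least one lowers the length, so
the total gain is at most one. -/
theorem Cover.length_eq {u : Perm (Fin n)} {i k : Fin n} (h : Cover u i k) :
    length (u * swap i k) = length u + 1 := by
  obtain ⟨d, hd⟩ : ∃ d : ℕ, (k : ℕ) = i + d := ⟨k - i, by have := h.1; omega⟩
  induction d generalizing u k with
  | zero => exact absurd h.1 (by rw [Fin.lt_def]; omega)
  | succ d ih =>
    refine le_antisymm ?_ (length_lt_mul_swap u h.1 h.2.1)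
    have hk := k.2
    set j : Fin n := ⟨i + d, by omega⟩ with hj
    have hjk : j < k := by rw [Fin.lt_def, hj]; simp; omega
    have hs : adjSwap n (i + d) = swap j k := by
      have h' : (i : ℕ) + d + 1 < n := by omega
      simp only [adjSwap, h', dif_pos]
      congr 1
      exact Fin.ext (by simp; omega)
    rcases Nat.eq_zero_or_pos d with rfl | hd0
    · have : i = j := Fin.ext (by simp [hj])
      rw [this, ← hs]
      exact length_mul_adjSwap_le _ _
    have hij : i < j := by rw [Fin.lt_def, hj]; simp; omega
    have hik := hij.ne
    have hc : Cover (u * swap j k) i j := by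
      refine ⟨hij, ?_, fun m h1 h2 h3 => ?_⟩
      · simpa [swap_apply_of_ne_of_ne hij.ne (hij.trans hjk).ne] using h.2.1
      · have h4 := h.2.2 m h1 (h2.trans hjk)
        simp only [Perm.mul_apply, swap_apply_left,
          swap_apply_of_ne_of_ne hij.ne (hij.trans hjk).ne,
          swap_apply_of_ne_of_ne h2.ne (h2.trans hjk).ne] at h3 ⊢
        exact h4 h3
    have h1 := ih hc (by simp [hj])
    have hconj : u * swap i k = u * swap j k * swap i j * swap j k := by
      rw [mul_assoc, mul_assoc, ← mul_assoc (swap j k),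
        swap_mul_swap_mul_swap hij.ne (hij.trans hjk).ne, swap_comm]
    have h2 := length_mul_adjSwap_le u (i + d)
    have h3 := length_mul_adjSwap_le (u * swap j k * swap i j) (i + d)
    rw [hs] at h2 h3
    rw [hconj]
    -- If `u i < u j`, the cover condition puts `u j` above `u k` and the first `s` is a descent;
    -- otherwise the second `s` is one.
    rcases lt_or_gt_of_ne (u.injective.ne hij.ne) with h4 | h4
    · have h5 := length_mul_swap_lt u hjk (h.2.2 j hij hjk h4)
      omega
    · have h5 := length_mul_swap_lt (u * swap j k * swap i j) hjk (by
        have e1 : k ≠ i := (hij.trans hjk).ne'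
        simpa [swap_apply_of_ne_of_ne hij.ne (hij.trans hjk).ne,
          swap_apply_of_ne_of_ne e1 hjk.ne'] using h4)
      omega

/-- For the converse, an intermediate entry in position `m` would let `t_{i,k}` be written as
`t_{i,m} t_{i,k} t_{m,k}` with three length-increasing steps, a gain of at least three. -/
theorem cover_iff_length {u : Perm (Fin n)} {i k : Fin n} (hik : i < k) :
    Cover u i k ↔ length (u * swap i k) = length u + 1 := by
  refine ⟨Cover.length_eq, fun h => ?_⟩
  have hlt : u i < u k := by
    by_contra h'
    have := length_mul_swap_lt u hik (lt_of_le_of_ne (not_lt.mp h') (u.injective.ne hik.ne'))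
    omega
  refine ⟨hik, hlt, fun m h1 h2 h3 => ?_⟩
  by_contra h4
  have h5 : u m < u k := lt_of_le_of_ne (not_lt.mp h4) (u.injective.ne h2.ne)
  have l1 := length_lt_mul_swap u h1 h3
  have l2 := length_lt_mul_swap (u * swap i m) hik (by
    simpa [swap_apply_of_ne_of_ne hik.ne' h2.ne'] using h5)
  have l3 := length_lt_mul_swap (u * swap i m * swap i k) h2 (by
    simpa [swap_apply_of_ne_of_ne h1.ne' h2.ne, swap_apply_of_ne_of_ne hik.ne' h2.ne'] using h3)
  have e : u * swap i m * swap i k * swap m k = u * swap i k := by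
    rw [mul_assoc, mul_assoc]
    congr 1
    have := h1.ne; have := h2.ne; have := hik.ne
    ext x
    simp only [Perm.mul_apply, swap_apply_def]
    split_ifs <;> simp_all
  rw [e] at l3
  omega

/-! ### Generating functions of reduced words -/

open Classical in
/-- The operator on functions of permutations dual to left multiplication in the nilCoxeter
algebra. -/
noncomputable def leftOp {R : Type*} [Zero R] (a : ℕ) (f : Perm (Fin n) → R) (w : Perm (Fin n)) :
    R :=
  if LeftDescent w a then f (adjSwap n a * w) else 0

open Classical in
/-- The sum, over the sublists of `P` whose first components form a reduced word of `w`, of the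
monomials given by the second components. -/
noncomputable def redPoly : List (ℕ × ℕ) → Perm (Fin n) → MvPolynomial ℕ ℤ
  | [], w => if w = 1 then 1 else 0
  | x :: P, w => redPoly P w + MvPolynomial.X x.2 * leftOp x.1 (redPoly P) w

open Classical in
/-- The difference of the sums of `f` over the covers of `u` that move the entry in position `k` to
the left and to the right, respectively. -/
noncomputable def monk {R : Type*} [AddCommGroup R] (k : Fin n) (f : Perm (Fin n) → R)
    (u : Perm (Fin n)) : R :=
  ∑ i, ((if Cover u i k then f (u * swap i k) else 0) -
    if Cover u k i then f (u * swap i k) else 0)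

/-! ### Commutation of `monk` with left multiplication -/

theorem leftDescent_mul_swap (u : Perm (Fin n)) (i k : Fin n) (a : ℕ) :
    LeftDescent (u * swap i k) a ↔
      ∃ h : a + 1 < n, swap i k (u.symm ⟨a + 1, h⟩) < swap i k (u.symm ⟨a, by omega⟩) := by
  unfold LeftDescent
  have : (u * swap i k).symm = swap i k * u.symm := by
    rw [← Perm.inv_def, mul_inv_rev, swap_inv, Perm.inv_def]
  rw [this]; rfl

/-- To reverse the order of the adjacent values `a` and `a + 1` by moving only one of them, the swap
would have to carry it past the other, whose intermediate value then contradicts the cover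
condition. So both must be swapped. -/
theorem cover_and_leftDescent_of_not {u : Perm (Fin n)} {a : ℕ} (h1 : a + 1 < n)
    (hd : ¬ LeftDescent u a) (i k : Fin n) :
    Cover u i k ∧ LeftDescent (u * swap i k) a ↔ (u i : ℕ) = a ∧ (u k : ℕ) = a + 1 := by
  have hPQ : u.symm ⟨a, by omega⟩ < u.symm ⟨a + 1, h1⟩ := by
    by_contra h
    exact hd ⟨h1, lt_of_le_of_ne (not_lt.mp h) (by simp)⟩
  rw [leftDescent_mul_swap]
  obtain ⟨P, hP⟩ : ∃ P, P = u.symm ⟨a, by omega⟩ := ⟨_, rfl⟩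
  obtain ⟨Q, hQ⟩ : ∃ Q, Q = u.symm ⟨a + 1, h1⟩ := ⟨_, rfl⟩
  have uP : (u P : ℕ) = a := by rw [hP]; simp
  have uQ : (u Q : ℕ) = a + 1 := by rw [hQ]; simp
  have iP : ∀ x, (u x : ℕ) = a ↔ x = P := fun x => by
    rw [← uP, Fin.val_inj, u.injective.eq_iff]
  have iQ : ∀ x, (u x : ℕ) = a + 1 ↔ x = Q := fun x => by
    rw [← uQ, Fin.val_inj, u.injective.eq_iff]
  simp only [← hP, ← hQ, h1, exists_true_left] at *
  rw [iP, iQ]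
  clear hP hQ hd
  constructor
  · rintro ⟨⟨hik, hu, hb⟩, hs⟩
    have eP := iP i; have eP' := iP k; have eQ := iQ i; have eQ' := iQ k
    have b1 := hb P; have b2 := hb Q
    simp only [Fin.lt_def, Fin.ext_iff, swap_apply_def] at *
    split_ifs at hs <;> omega
  · rintro ⟨rfl, rfl⟩
    refine ⟨⟨hPQ, by rw [Fin.lt_def]; omega, fun m _ _ h => ?_⟩, by simpa using hPQ⟩
    have := iQ m
    rw [Fin.lt_def] at *
    have h' : (u m : ℕ) ≠ a + 1 := fun e => by have := this.mp e; subst this; omega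
    omega

/-- Left multiplication by `s_a` only exchanges two adjacent values, so it affects no comparison
except the one between them. The excluded pair is the one for which `s_a u` is covered by `u`
itself. -/
theorem cover_and_leftDescent_of {u : Perm (Fin n)} {a : ℕ}
    (hd : LeftDescent u a) (i k : Fin n)
    (hik : ¬ ((u i : ℕ) = a + 1 ∧ (u k : ℕ) = a)) :
    Cover u i k ∧ LeftDescent (u * swap i k) a ↔ Cover (adjSwap n a * u) i k := by
  obtain ⟨h1, hPQ⟩ := hd
  rw [leftDescent_mul_swap]
  obtain ⟨P, hP⟩ : ∃ P, P = u.symm ⟨a, by omega⟩ := ⟨_, rfl⟩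
  obtain ⟨Q, hQ⟩ : ∃ Q, Q = u.symm ⟨a + 1, h1⟩ := ⟨_, rfl⟩
  have uP : (u P : ℕ) = a := by rw [hP]; simp
  have uQ : (u Q : ℕ) = a + 1 := by rw [hQ]; simp
  have iP : ∀ x, (u x : ℕ) = a ↔ x = P := fun x => by
    rw [← uP, Fin.val_inj, u.injective.eq_iff]
  have iQ : ∀ x, (u x : ℕ) = a + 1 ↔ x = Q := fun x => by
    rw [← uQ, Fin.val_inj, u.injective.eq_iff]
  simp only [← hP, ← hQ, h1, exists_true_left] at *
  clear hP hQ
  obtain ⟨v, hv⟩ : ∃ v, v = adjSwap n a * u := ⟨_, rfl⟩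
  have key : ∀ x : Fin n, (x = P ∧ (u x : ℕ) = a ∧ (v x : ℕ) = a + 1) ∨
      (x = Q ∧ (u x : ℕ) = a + 1 ∧ (v x : ℕ) = a) ∨
      (x ≠ P ∧ x ≠ Q ∧ (u x : ℕ) ≠ a ∧ (u x : ℕ) ≠ a + 1 ∧ (v x : ℕ) = u x) := fun x => by
    have := iP x; have := iQ x
    rw [hv, Perm.mul_apply, val_adjSwap h1]
    split_ifs <;> grind
  rw [← hv]
  clear hv iP iQ
  have kP := key P; have kQ := key Q
  unfold Cover
  have ki := key i; have kk := key k
  simp only [Fin.lt_def, Fin.ext_iff, swap_apply_def] at *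
  constructor
  · rintro ⟨⟨h2, h3, hb⟩, hs⟩
    refine ⟨h2, ?_, fun m m1 m2 m3 => ?_⟩
    · clear hs kP kQ hb; omega
    · have b := hb m m1 m2
      have km := key m
      clear hb key
      split_ifs at hs <;> omega
  · rintro ⟨h2, h3, hb⟩
    have bP := hb P; have bQ := hb Q
    refine ⟨⟨h2, ?_, fun m m1 m2 m3 => ?_⟩, ?_⟩
    · clear kP kQ hb bP bQ; omega
    · have b := hb m m1 m2
      have km := key m
      clear hb key
      omega
    · clear hb key
      split_ifs <;> omega

/-- All terms of the two sums match except those that swap the values `a` and `a + 1`. If `a` is not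
a left descent, these terms are all that survives on the left; if it is one, they occur on the right
as the cover from `s_a u` back to `u`, and the correction cancels them. -/
theorem monk_leftOp {R : Type*} [AddCommGroup R] (k : Fin n) (f : Perm (Fin n) → R) {a : ℕ}
    (h1 : a + 1 < n) (u : Perm (Fin n)) :
    monk k (leftOp a f) u = leftOp a (monk k f) u +
      ((if (u k : ℕ) = a + 1 then f u else 0) - if (u k : ℕ) = a then f u else 0) := by
  classical
  have hs : ∀ i k, (u i : ℕ) = a → (u k : ℕ) = a + 1 →
      f (adjSwap n a * (u * swap i k)) = f u := fun i k hi hk => by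
    rw [← mul_assoc, adjSwap_mul_eq u hk hi, mul_assoc, swap_comm]; simp
  have hL : monk k (leftOp a f) u = ∑ i,
      ((if Cover u i k ∧ LeftDescent (u * swap i k) a then
          f (adjSwap n a * (u * swap i k)) else 0) -
        if Cover u k i ∧ LeftDescent (u * swap k i) a then
          f (adjSwap n a * (u * swap i k)) else 0) := by
    unfold monk leftOp
    refine Finset.sum_congr rfl fun i _ => ?_
    rw [swap_comm k i, ← ite_and, ← ite_and]
  obtain ⟨P, hP⟩ : ∃ P, (u P : ℕ) = a := ⟨u.symm ⟨a, by omega⟩, by simp⟩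
  obtain ⟨Q, hQ⟩ : ∃ Q, (u Q : ℕ) = a + 1 := ⟨u.symm ⟨a + 1, h1⟩, by simp⟩
  have iP : ∀ x, (u x : ℕ) = a ↔ x = P := fun x => by
    rw [← hP, Fin.val_inj, u.injective.eq_iff]
  have iQ : ∀ x, (u x : ℕ) = a + 1 ↔ x = Q := fun x => by
    rw [← hQ, Fin.val_inj, u.injective.eq_iff]
  have hne : P ≠ Q := fun e => by subst e; omega
  have hdelta : ∑ i, ((if (u i : ℕ) = a ∧ (u k : ℕ) = a + 1 then f u else 0) -
      if (u k : ℕ) = a ∧ (u i : ℕ) = a + 1 then f u else 0) =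
      (if (u k : ℕ) = a + 1 then f u else 0) - if (u k : ℕ) = a then f u else 0 := by
    rw [Finset.sum_sub_distrib]
    simp only [iP, iQ, and_comm (b := k = Q), ite_and]
    simp
  by_cases hd : LeftDescent u a
  · have hR : leftOp a (monk k f) u = ∑ i, ((if Cover (adjSwap n a * u) i k then
          f (adjSwap n a * (u * swap i k)) else 0) -
        if Cover (adjSwap n a * u) k i then f (adjSwap n a * (u * swap i k)) else 0) := by
      rw [leftOp, if_pos hd]
      simp only [monk, mul_assoc]
    rw [hL, hR, ← hdelta, ← Finset.sum_add_distrib]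
    have hsP : (adjSwap n a (u P) : ℕ) = a + 1 := by rw [val_adjSwap h1]; simp [hP]
    have hsQ : (adjSwap n a (u Q) : ℕ) = a := by rw [val_adjSwap h1]; simp [hQ]
    have hQP : Q < P := by
      obtain ⟨i, j, hij, hi, hj⟩ := (leftDescent_iff u a).mp hd
      rwa [(iP j).mp hj, (iQ i).mp hi] at hij
    -- No value lies strictly between `a` and `a + 1`, so nothing can obstruct this cover.
    have hcov : Cover (adjSwap n a * u) Q P := by
      refine ⟨hQP, ?_, fun m _ h2 h3 => ?_⟩
      · simp only [Perm.mul_apply, Fin.lt_def]; omega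
      · have : ((adjSwap n a * u) m : ℕ) ≠ (adjSwap n a * u) P := fun e =>
          h2.ne ((adjSwap n a * u).injective (Fin.ext e))
        simp only [Perm.mul_apply, Fin.lt_def] at *
        omega
    have hncov : ¬ Cover u Q P := fun h => by
      have := h.2.1
      rw [Fin.lt_def] at this; omega
    have hncov1 : ¬ Cover u P Q := fun h => absurd h.1 (not_lt.mpr hQP.le)
    have hncov2 : ¬ Cover (adjSwap n a * u) P Q := fun h => absurd h.1 (not_lt.mpr hQP.le)
    refine Finset.sum_congr rfl fun i _ => ?_
    by_cases c1 : (u i : ℕ) = a ∧ (u k : ℕ) = a + 1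
    · have e1 := (iP i).mp c1.1
      have e2 := (iQ k).mp c1.2
      subst e1 e2
      simp [hncov, hncov1, hncov2, hcov, hs i k hP hQ, hP, hQ]
    by_cases c2 : (u k : ℕ) = a ∧ (u i : ℕ) = a + 1
    · have e1 := (iQ i).mp c2.2
      have e2 := (iP k).mp c2.1
      subst e1 e2
      simp [hncov, hncov1, hncov2, hcov, swap_comm i k, hs k i hP hQ, hP, hQ]
    rw [if_neg c1, if_neg c2]
    have c1' : ¬ ((u k : ℕ) = a + 1 ∧ (u i : ℕ) = a) := fun h => c1 h.symm
    have c2' : ¬ ((u i : ℕ) = a + 1 ∧ (u k : ℕ) = a) := fun h => c2 h.symm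
    simp only [cover_and_leftDescent_of hd _ _ c1', cover_and_leftDescent_of hd _ _ c2']
    simp
  · rw [hL, leftOp, if_neg hd, zero_add, ← hdelta]
    refine Finset.sum_congr rfl fun i _ => ?_
    simp only [cover_and_leftDescent_of_not h1 hd]
    congr 1
    · split_ifs with h
      · exact hs i k h.1 h.2
      · rfl
    · split_ifs with h
      · rw [swap_comm]; exact hs k i h.1 h.2
      · rfl

theorem monk_add {R : Type*} [AddCommGroup R] (k : Fin n) (f g : Perm (Fin n) → R)
    (u : Perm (Fin n)) : monk k (fun w => f w + g w) u = monk k f u + monk k g u := by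
  unfold monk
  rw [← Finset.sum_add_distrib]
  refine Finset.sum_congr rfl fun i _ => ?_
  rw [← add_sub_add_comm]
  split_ifs <;> simp

theorem monk_mul_left {R : Type*} [CommRing R] (k : Fin n) (x : R) (f : Perm (Fin n) → R)
    (u : Perm (Fin n)) : monk k (fun w => x * f w) u = x * monk k f u := by
  unfold monk
  rw [Finset.mul_sum]
  refine Finset.sum_congr rfl fun i _ => ?_
  split_ifs <;> ring

/-- The entry in position `k` is neither a left-to-right minimum nor a right-to-left maximum. -/
def IsMiddle (k : Fin n) (u : Perm (Fin n)) : Prop :=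
  (∃ i, i < k ∧ u i < u k) ∧ ∃ j, k < j ∧ u k < u j

/-- Multiplying by `s_a` at a left descent removes one inversion and creates none. -/
theorem LeftDescent.lt_of_lt {u : Perm (Fin n)} {a : ℕ} (hd : LeftDescent u a) {i j : Fin n}
    (hij : i < j) (h : u i < u j) : (adjSwap n a * u) i < (adjSwap n a * u) j := by
  obtain ⟨P, Q, hPQ, hP, hQ⟩ := (leftDescent_iff u a).mp hd
  have h1 : a + 1 < n := hP ▸ (u P).2
  have : ¬ ((u i : ℕ) = a ∧ (u j : ℕ) = a + 1) := fun ⟨e1, e2⟩ => by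
    have e3 : j = P := u.injective (Fin.ext (e2.trans hP.symm))
    have e4 : i = Q := u.injective (Fin.ext (e1.trans hQ.symm))
    subst e3 e4
    exact absurd hij (not_lt.mpr hPQ.le)
  simp only [Perm.mul_apply, Fin.lt_def, val_adjSwap h1] at *
  split_ifs <;> omega

theorem IsMiddle.adjSwap_mul {k : Fin n} {u : Perm (Fin n)} (h : IsMiddle k u) {a : ℕ}
    (hd : LeftDescent u a) : IsMiddle k (adjSwap n a * u) := by
  obtain ⟨⟨i, hi, hi'⟩, j, hj, hj'⟩ := h
  exact ⟨⟨i, hi, hd.lt_of_lt hi hi'⟩, j, hj, hd.lt_of_lt hj hj'⟩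

/-- The letters `N - 1, …, 0`, each paired with `b`. -/
def block (N b : ℕ) : List (ℕ × ℕ) :=
  (List.range N).reverse.map fun a => (a, b)

theorem block_succ (N b : ℕ) : block (N + 1) b = (N, b) :: block N b := by
  simp [block, List.range_succ]

/-- The right-hand side is the invariant of a telescoping sum. On prepending the letter `c`, the
negative correction in `monk_leftOp` cancels the term with `u k = c`, and the positive one supplies
the term with `u k = c + 1`. -/
theorem monk_redPoly_block (k : Fin n) (P : List (ℕ × ℕ)) (b : ℕ)
    (hP : ∀ u, IsMiddle k u → monk k (redPoly P) u = 0) (c : ℕ) (hc : c + 1 ≤ n) :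
    ∀ u, IsMiddle k u → monk k (redPoly (block c b ++ P)) u =
      MvPolynomial.X b * if (u k : ℕ) = c then redPoly (block c b ++ P) u else 0 := by
  induction c with
  | zero =>
    intro u hu
    -- A smaller entry to the left of position `k` rules out `u k = 0`, so the invariant starts at
    -- zero.
    obtain ⟨⟨i, -, hi⟩, -⟩ := id hu
    rw [Fin.lt_def] at hi
    rw [if_neg (by omega)]
    simpa [block] using hP u hu
  | succ c ih =>
    intro u hu
    have ih := ih (by omega)
    rw [block_succ, List.cons_append]
    set Q := block c b ++ P
    have e : redPoly ((c, b) :: Q) =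
        fun w : Perm (Fin n) => redPoly Q w + MvPolynomial.X b * leftOp c (redPoly Q) w := rfl
    rw [e, monk_add, monk_mul_left, monk_leftOp k _ (by omega), ih u hu]
    have hD : leftOp c (monk k (redPoly Q)) u =
        MvPolynomial.X b * if (u k : ℕ) = c + 1 then leftOp c (redPoly Q) u else 0 := by
      unfold leftOp
      split_ifs with h1 h2
      -- The value `c + 1` in position `k` of `u` becomes `c` in `s_c u`, where the induction
      -- hypothesis detects it.
      · rw [ih _ (hu.adjSwap_mul h1), if_pos]
        rw [Perm.mul_apply, val_adjSwap (by omega)]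
        simp [h2]
      · rw [ih _ (hu.adjSwap_mul h1), if_neg]
        rw [Perm.mul_apply, val_adjSwap (by omega)]
        split_ifs <;> omega
      · simp
      · simp
    rw [hD]
    split_ifs <;> first | omega | ring

/-- The letters `N - 1, …, 0` repeated once for each of the variables `b` in a list. -/
def blocks (N : ℕ) (B : List ℕ) : List (ℕ × ℕ) :=
  B.flatMap (block N)

/-- After a complete block the remaining term requires `u k = n - 1`, which is excluded by the
larger entry to the right of position `k`. For the empty list, the identity covers no permutation.
-/
theorem monk_redPoly_blocks (k : Fin n) (B : List ℕ) (u : Perm (Fin n)) (hu : IsMiddle k u) :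
    monk k (redPoly (blocks (n - 1) B)) u = 0 := by
  have hn := k.2
  induction B generalizing u with
  | nil =>
    refine Finset.sum_eq_zero fun i _ => ?_
    simp only [blocks, List.flatMap_nil, redPoly]
    have h : ∀ i j, Cover u i j → u * swap i j ≠ 1 := fun i j hc h1 => by
      have : u = swap i j := by rwa [mul_eq_one_iff_eq_inv, swap_inv] at h1
      have h2 := hc.2.1
      rw [this, swap_apply_left, swap_apply_right] at h2
      exact absurd hc.1 (not_lt.mpr h2.le)
    split_ifs with h1 h2 h3 h4 h5 <;> first | rfl | skip
    · exact absurd h2 (h _ _ h1)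
    · exact absurd h2 (h _ _ h1)
    · rw [swap_comm] at *
      exact absurd ‹_› (h _ _ h5)
  | cons b B ih =>
    have := monk_redPoly_block k (blocks (n - 1) B) b ih (n - 1) (by omega) u hu
    rw [blocks, List.flatMap_cons, ← blocks, this, if_neg, mul_zero]
    obtain ⟨-, j, -, hj⟩ := hu
    rw [Fin.lt_def] at hj
    have := (u j).2
    omega

/-! ### Stanley functions as sums over sublists of a fixed word -/

/-- `L` is a reduced word of `w`, the letters being given as natural numbers. -/
def IsRed (w : Perm (Fin n)) (L : List ℕ) : Prop :=
  ∃ L' : List (Fin (n - 1)), L'.map Fin.val = L ∧ IsReducedWord w L'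

theorem length_one : length (1 : Perm (Fin n)) = 0 :=
  Nat.le_zero.mp (length_le_of_word (n := n) [])

theorem isRed_nil (w : Perm (Fin n)) : IsRed w [] ↔ w = 1 := by
  constructor
  · rintro ⟨L', h, h', -⟩
    rw [List.map_eq_nil_iff] at h
    subst h
    exact h'.symm
  · rintro rfl
    exact ⟨[], rfl, rfl, length_one.symm⟩

theorem isRed_cons (w : Perm (Fin n)) (a : ℕ) (L : List ℕ) :
    IsRed w (a :: L) ↔ LeftDescent w a ∧ IsRed (adjSwap n a * w) L := by
  constructor
  · rintro ⟨L', h, rfl, hl⟩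
    obtain ⟨a', L'', rfl, rfl, rfl⟩ := List.map_eq_cons_iff.mp h
    have e : adjSwap n a' * wordProd (a' :: L'') = wordProd L'' := by
      rw [wordProd, List.map_cons, List.prod_cons, simpleTransposition_eq, ← mul_assoc,
        adjSwap_mul_self, one_mul, wordProd]
    have h1 := length_le_of_word L''
    have h2 := length_adjSwap_mul_le (adjSwap n a' * wordProd (a' :: L'')) a'
    rw [← mul_assoc, adjSwap_mul_self, one_mul] at h2
    rw [e] at h2
    rw [List.length_cons] at hl
    have h3 : (a' : ℕ) + 1 < n := by omega
    refine ⟨(leftDescent_iff_length h3).mpr ?_, L'', rfl, e.symm, ?_⟩ <;> rw [e] <;> omega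
  · rintro ⟨hd, L', rfl, h1, h2⟩
    have h3 : a + 1 < n := hd.1
    refine ⟨⟨a, by omega⟩ :: L', rfl, ?_, ?_⟩
    · rw [wordProd, List.map_cons, List.prod_cons, simpleTransposition_eq, ← wordProd, h1,
        ← mul_assoc, adjSwap_mul_self, one_mul]
    · rw [List.length_cons, h2, hd.length_eq]

/-- The exponent of the monomial given by the second components of the entries of `L`. -/
noncomputable def weight {α : Type*} (L : List (α × ℕ)) : ℕ →₀ ℕ :=
  (L.map fun x => Finsupp.single x.2 1).sum

open Classical in
theorem redPoly_eq_sum (P : List (ℕ × ℕ)) (w : Perm (Fin n)) :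
    redPoly P w = (P.sublists'.map fun L =>
      if IsRed w (L.map Prod.fst) then MvPolynomial.monomial (weight L) (1 : ℤ) else 0).sum := by
  induction P generalizing w with
  | nil => simp [redPoly, isRed_nil, weight]
  | cons x P ih =>
    rw [redPoly, List.sublists'_cons, List.map_append, List.sum_append, ← ih, List.map_map]
    congr 1
    unfold leftOp
    split_ifs with h
    · rw [ih, ← List.sum_map_mul_left]
      congr 1
      refine List.map_congr_left fun L _ => ?_
      simp only [Function.comp, List.map_cons, isRed_cons, h, true_and]
      split_ifs
      · rw [MvPolynomial.X, MvPolynomial.monomial_mul, one_mul]; simp [weight]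
      · simp
    · rw [mul_zero]
      symm
      apply List.sum_eq_zero
      simp [isRed_cons, h]

/-- The order of the pairs of a letter and a variable in which the pairs belonging to a term of the
Stanley symmetric function are strictly increasing. -/
def PairLT (x y : ℕ × ℕ) : Prop :=
  x.2 < y.2 ∨ x.2 = y.2 ∧ y.1 < x.1

instance : IsTrans (ℕ × ℕ) PairLT :=
  ⟨fun x y z h1 h2 => by unfold PairLT at *; omega⟩

instance : Std.Irrefl PairLT :=
  ⟨fun x h => by unfold PairLT at *; omega⟩

instance : Std.Antisymm PairLT :=
  ⟨fun x y h1 h2 => by unfold PairLT at *; omega⟩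

theorem pairwise_blocks (N m : ℕ) : (blocks N (List.range m)).Pairwise PairLT := by
  unfold blocks
  rw [List.pairwise_flatMap]
  constructor
  · intro b _
    rw [block, List.pairwise_map, List.pairwise_reverse]
    exact List.pairwise_lt_range.imp fun h => Or.inr ⟨rfl, h⟩
  · refine List.pairwise_lt_range.imp fun {b c} h x hx y hy => ?_
    simp only [block, List.mem_map] at hx hy
    obtain ⟨-, -, rfl⟩ := hx
    obtain ⟨-, -, rfl⟩ := hy
    exact Or.inl h

theorem mem_blocks {N : ℕ} {B : List ℕ} {x : ℕ × ℕ} :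
    x ∈ blocks N B ↔ x.1 < N ∧ x.2 ∈ B := by
  obtain ⟨a, b⟩ := x
  simp [blocks, block, and_comm]

theorem PairLT.nodup {P : List (ℕ × ℕ)} (h : P.Pairwise PairLT) : P.Nodup :=
  h.imp fun h e => by subst e; exact irrefl _ h

theorem weight_map {α β : Type*} (f : α → β) (L : List (α × ℕ)) :
    weight (L.map (Prod.map f id)) = weight L := by
  simp [weight, Function.comp_def]

theorem single_le_weight {α : Type*} {L : List (α × ℕ)} {x : α × ℕ} (hx : x ∈ L) :
    0 < weight L x.2 := by
  induction L with
  | nil => simp at hx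
  | cons y L ih =>
    simp only [weight, List.map_cons, List.sum_cons, Finsupp.add_apply] at *
    rcases List.mem_cons.mp hx with rfl | h
    · simp
    · have := ih h; omega

theorem not_isReducedWord_cons_cons (w : Perm (Fin n)) (a : Fin (n - 1)) (L : List (Fin (n - 1))) :
    ¬ IsReducedWord w (a :: a :: L) := by
  rintro ⟨rfl, h⟩
  have : wordProd (a :: a :: L) = wordProd L := by
    simp only [wordProd, List.map_cons, List.prod_cons, simpleTransposition_eq]
    rw [← mul_assoc, adjSwap_mul_self, one_mul]
  have h2 := length_le_of_word L
  rw [this] at h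
  simp at h
  omega

theorem isReducedWord_tail {w : Perm (Fin n)} {a : Fin (n - 1)} {L : List (Fin (n - 1))}
    (h : IsReducedWord w (a :: L)) : IsReducedWord (adjSwap n a * w) L := by
  have h' : IsRed w (a.val :: L.map Fin.val) := ⟨a :: L, rfl, h⟩
  obtain ⟨-, L', e, h2⟩ := (isRed_cons _ _ _).mp h'
  rwa [List.map_injective_iff.mpr Fin.val_injective e] at h2

/-- Neighbouring letters of a reduced word differ, so where `b` stays constant the weak descent of
the letters is strict. -/
theorem pairwise_of_mem_stanleyIndex {w : Perm (Fin n)} {L : List (Fin (n - 1) × ℕ)}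
    (h : L ∈ stanleyIndex w) : (L.map (Prod.map Fin.val id)).Pairwise PairLT := by
  rw [← List.isChain_iff_pairwise, List.isChain_map]
  obtain ⟨hr, hc⟩ := h
  induction L generalizing w with
  | nil => simp
  | cons x L ih =>
    rw [List.map_cons] at hr
    have ih := ih (isReducedWord_tail hr) hc.tail
    cases L with
    | nil => simp
    | cons y L =>
      rw [List.isChain_cons_cons] at hc ⊢
      refine ⟨?_, ih⟩
      have hne : x.1 ≠ y.1 := fun e => by
        rw [List.map_cons, ← e] at hr
        exact not_isReducedWord_cons_cons _ _ _ hr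
      obtain ⟨h1, h2⟩ := hc.1
      simp only [PairLT, Prod.map_fst, Prod.map_snd, id]
      rw [Fin.lt_def] at h2
      rw [Ne, Fin.ext_iff] at hne
      omega

theorem isChain_of_pairwise {L : List (Fin (n - 1) × ℕ)}
    (h : (L.map (Prod.map Fin.val id)).Pairwise PairLT) :
    L.IsChain (fun x y => x.2 ≤ y.2 ∧ (x.1 < y.1 → x.2 < y.2)) := by
  rw [← List.isChain_iff_pairwise, List.isChain_map] at h
  refine h.imp fun x y h => ?_
  simp only [PairLT, Prod.map_fst, Prod.map_snd, id] at h
  rw [Fin.lt_def]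
  omega

theorem sublist_of_pairwise {P Q : List (ℕ × ℕ)} (hP : P.Pairwise PairLT)
    (hQ : Q.Pairwise PairLT) (h : P ⊆ Q) : P.Sublist Q :=
  List.sublist_of_subperm_of_pairwise ((PairLT.nodup hP).subperm h) hP hQ

open Classical in
-- The strictly increasing lists of pairs with letters below `N` and variables below `m` are exactly
-- the sublists of `blocks N (List.range m)`. A bound `N` beyond `n - 1` is harmless, as the extra
-- letters occur in no reduced word; this freedom allows permutations of sets of different sizes to
-- be compared.
theorem stanley_apply (w : Perm (Fin n)) {N m : ℕ} (hN : n - 1 ≤ N) (d : ℕ →₀ ℕ)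
    (hd : ∀ b ∈ d.support, b < m) :
    stanley w d = MvPolynomial.coeff d (redPoly (blocks N (List.range m)) w) := by
  set P := blocks N (List.range m)
  have hP : P.Pairwise PairLT := pairwise_blocks N m
  have hcoeff : MvPolynomial.coeff d (redPoly P w) = ((P.sublists'.filter fun L =>
      IsRed w (L.map Prod.fst) ∧ weight L = d).length : ℤ) := by
    rw [redPoly_eq_sum]
    generalize P.sublists' = S
    induction S with
    | nil => simp
    | cons L S ih =>
      rw [List.map_cons, List.sum_cons, MvPolynomial.coeff_add, ih, List.filter_cons]
      by_cases h1 : IsRed w (L.map Prod.fst) <;> by_cases h2 : weight L = d <;>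
        simp [h1, h2, MvPolynomial.coeff_monomial, add_comm]
  have hnd : (P.sublists'.filter fun L => IsRed w (L.map Prod.fst) ∧ weight L = d).Nodup :=
    (List.nodup_sublists'.mpr (PairLT.nodup hP)).filter _
  rw [hcoeff, ← List.toFinset_card_of_nodup hnd, ← Set.ncard_coe_finset]
  have hinj : Function.Injective
      (List.map (Prod.map Fin.val id) : List (Fin (n - 1) × ℕ) → List (ℕ × ℕ)) :=
    List.map_injective_iff.mpr (Function.Injective.prodMap Fin.val_injective Function.injective_id)
  unfold stanley
  rw [← Set.ncard_image_of_injective _ hinj]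
  congr 2
  ext L
  simp only [Set.mem_image, Set.mem_ofPred_eq, List.coe_toFinset, List.mem_filter, List.mem_sublists',
    decide_eq_true_eq]
  constructor
  · rintro ⟨L, ⟨hL, hw⟩, rfl⟩
    refine ⟨sublist_of_pairwise (pairwise_of_mem_stanleyIndex hL) hP fun x hx => ?_,
      ⟨L.map Prod.fst, by simp [Function.comp_def], hL.1⟩, (weight_map _ _).trans hw⟩
    obtain ⟨y, hy, rfl⟩ := List.mem_map.mp hx
    refine mem_blocks.mpr ⟨lt_of_lt_of_le y.1.2 hN, List.mem_range.mpr (hd _ ?_)⟩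
    rw [Finsupp.mem_support_iff, ← hw]
    exact (single_le_weight hy).ne'
  · rintro ⟨hs, ⟨L', h1, h2⟩, hw⟩
    -- The letters of `L` are values of letters of a reduced word, so `L` lifts to a list of pairs
    -- with letters in `Fin (n - 1)`.
    obtain ⟨L₀, rfl⟩ : ∃ L₀ : List (Fin (n - 1) × ℕ), L₀.map (Prod.map Fin.val id) = L := by
      refine ⟨List.zip L' (L.map Prod.snd), ?_⟩
      rw [← List.zip_map, h1, List.map_id]
      exact (List.zip_of_prod rfl rfl).symm
    refine ⟨L₀, ⟨⟨?_, isChain_of_pairwise (hP.sublist hs)⟩, (weight_map _ _).symm.trans hw⟩, rfl⟩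
    convert h2
    apply List.map_injective_iff.mpr Fin.val_injective
    rw [h1]
    simp

/-! ### The transition formula along the modified LS-tree -/

/-- The defining properties of the indices `p` and `q` of a non-dominant permutation. -/
structure IsPivot (w : Perm (Fin n)) (p q : Fin n) : Prop where
  lt : p < q
  val_lt : w q < w p
  exists_lt : ∃ i, i < p ∧ w i < w q
  le_left : ∀ i t j, i < t → t < j → w i < w j → w j < w t → t ≤ p
  le_right : ∀ i j, p < j → w j < w p → i < p → w i < w j → j ≤ q

theorem isPivot_index {w : Perm (Fin n)} (h : ¬ IsDominant w) :
    IsPivot w (pIndex w h) (qIndex w h) := by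
  have hq : qIndex w h ∈ qCandidates w (pIndex w h) := Finset.max'_mem _ _
  obtain ⟨h1, h2, h3⟩ := (Finset.mem_filter.mp hq).2
  refine ⟨h1, h2, h3, fun i t j a b c d => ?_, fun i j a b c d => ?_⟩
  · exact Finset.le_max' _ _ (Finset.mem_filter.mpr ⟨Finset.mem_univ _, i, j, a, b, c, d⟩)
  · exact Finset.le_max' _ _ (Finset.mem_filter.mpr ⟨Finset.mem_univ _, a, b, i, c, d⟩)

theorem IsPivot.isMiddle {w : Perm (Fin n)} {p q : Fin n} (h : IsPivot w p q) :
    IsMiddle p (w * swap p q) := by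
  obtain ⟨i, hi, hi'⟩ := h.exists_lt
  refine ⟨⟨i, hi, ?_⟩, q, h.lt, ?_⟩
  · simpa [swap_apply_of_ne_of_ne hi.ne (hi.trans h.lt).ne] using hi'
  · simpa using h.val_lt

/-- Write `u = w t_{p,q}`, so `u p = w q`. An entry above `w q` strictly between `p` and `q` would
be the peak of a 132 pattern to the right of `p`. To the right of `q`, an entry above `w p` is
blocked by `u q = w p`, and one between `w q` and `w p` contradicts the maximality of `q`. -/
theorem IsPivot.cover_iff {w : Perm (Fin n)} {p q : Fin n} (h : IsPivot w p q) (j : Fin n) :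
    Cover (w * swap p q) p j ↔ j = q := by
  obtain ⟨i, hi, hi'⟩ := h.exists_lt
  have hpq := h.lt
  have hv : ∀ x, p < x → x ≠ q → (w * swap p q) x = w x := fun x hx hxq => by
    rw [Perm.mul_apply, swap_apply_of_ne_of_ne hx.ne' hxq]
  have hup : (w * swap p q) p = w q := by simp
  have huq : (w * swap p q) q = w p := by simp
  have hmid : ∀ m, p < m → m < q → ¬ w q < w m := fun m h1 h2 h3 =>
    absurd (h.le_left i m q (hi.trans h1) h2 hi' h3) (not_le.mpr h1)
  constructor
  · rintro ⟨h1, h2, h3⟩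
    by_contra hj
    rw [hup, hv j h1 hj] at h2
    have h4 : q < j := lt_of_not_ge fun hle => hmid j h1 (lt_of_le_of_ne hle hj) h2
    rcases lt_or_gt_of_ne (w.injective.ne h1.ne) with h5 | h5
    · have := h3 q hpq h4 (by rw [hup, huq]; exact h.val_lt)
      rw [hv j h1 hj, huq] at this
      exact absurd h5 (not_lt.mpr this.le)
    · exact absurd (h.le_right i j h1 h5 hi (hi'.trans h2)) (not_le.mpr h4)
  · rintro rfl
    refine ⟨hpq, by rw [hup, huq]; exact h.val_lt, fun m h1 h2 h3 => ?_⟩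
    rw [hup, hv m h1 h2.ne] at h3
    exact absurd h3 (hmid m h1 h2)

theorem mem_leftCovers {u : Perm (Fin n)} {i k : Fin n} : i ∈ leftCovers u k ↔ Cover u i k := by
  simp only [leftCovers, Finset.mem_filter, Finset.mem_univ, true_and]
  exact ⟨fun h => (cover_iff_length h.1).mpr h.2, fun h => ⟨h.1, h.length_eq⟩⟩

theorem sum_transitions {M : Type*} [AddCommMonoid M] (u : Perm (Fin n)) (k : Fin n)
    (f : Perm (Fin n) → M) :
    ∑ v ∈ transitions u k, f v = ∑ i ∈ leftCovers u k, f (u * swap i k) := by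
  unfold transitions
  refine Finset.sum_image fun i _ j _ h => ?_
  have := congrArg (fun g : Perm (Fin n) => g k) (mul_left_cancel h)
  simpa using this

theorem stanley_eq_sum_transitions {w : Perm (Fin n)} {p q : Fin n} (h : IsPivot w p q) :
    stanley w = ∑ v ∈ transitions (w * swap p q) p, stanley v := by
  classical
  funext d
  obtain ⟨m, hm⟩ : ∃ m, ∀ b ∈ d.support, b < m :=
    ⟨d.support.sup id + 1, fun b hb => Nat.lt_succ_of_le (Finset.le_sup (f := id) hb)⟩
  -- The vanishing of `monk` at `w t_{p,q}` equates the sum over the children with the sum over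
  -- covers to the right of `p`, whose only term is `w`.
  have hmonk := monk_redPoly_blocks p (List.range m) _ h.isMiddle
  unfold monk at hmonk
  rw [Finset.sum_sub_distrib, sub_eq_zero] at hmonk
  simp only [h.cover_iff, Finset.sum_ite_eq', Finset.mem_univ, if_true, swap_comm q p, mul_assoc,
    swap_mul_self, mul_one] at hmonk
  have e : (∑ v ∈ transitions (w * swap p q) p, stanley v) d =
      ∑ v ∈ transitions (w * swap p q) p, stanley v d := Finset.sum_apply _ _ _
  rw [e, sum_transitions, stanley_apply w le_rfl d hm, ← hmonk, ← Finset.sum_filter]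
  rw [MvPolynomial.coeff_sum]
  refine Finset.sum_congr ?_ fun i _ => ?_
  · ext i; simp [mem_leftCovers]
  · rw [stanley_apply _ le_rfl d hm, mul_assoc]

theorem childLabels_of_not_isDominant {w : Perm (Fin n)} (h : ¬ IsDominant w) :
    childLabels w = transitions (w * swap (pIndex w h) (qIndex w h)) (pIndex w h) := by
  rw [childLabels, dif_neg h]

theorem childLabels_of_isDominant {w : Perm (Fin n)} (h : IsDominant w) : childLabels w = ∅ := by
  rw [childLabels, dif_pos h]

theorem stanley_eq_sum_childLabels {w : Perm (Fin n)} (h : ¬ IsDominant w) :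
    stanley w = ∑ v ∈ childLabels w, stanley v := by
  rw [childLabels_of_not_isDominant h]
  exact stanley_eq_sum_transitions (isPivot_index h)

/-- The largest entry below `u p` to the left of `p` gives a cover. Hence non-dominant nodes are
never leaves. -/
theorem IsPivot.exists_cover {w : Perm (Fin n)} {p q : Fin n} (h : IsPivot w p q) :
    ∃ i, Cover (w * swap p q) i p := by
  set u := w * swap p q
  obtain ⟨⟨i, hi, hi'⟩, -⟩ := h.isMiddle
  obtain ⟨i, hi, hmax⟩ := Finset.exists_max_image
    (Finset.univ.filter fun i => i < p ∧ u i < u p) u ⟨i, Finset.mem_filter.mpr ⟨Finset.mem_univ _, hi, hi'⟩⟩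
  rw [Finset.mem_filter] at hi
  refine ⟨i, hi.2.1, hi.2.2, fun m _ h2 h3 => ?_⟩
  by_contra h4
  have := hmax m (Finset.mem_filter.mpr ⟨Finset.mem_univ _, h2,
    lt_of_le_of_ne (not_lt.mp h4) (u.injective.ne h2.ne)⟩)
  exact absurd h3 (not_lt.mpr this)

theorem childLabels_eq_empty_iff {w : Perm (Fin n)} : childLabels w = ∅ ↔ IsDominant w := by
  refine ⟨fun he => ?_, childLabels_of_isDominant⟩
  by_contra h
  obtain ⟨i, hi⟩ := (isPivot_index h).exists_cover
  rw [childLabels_of_not_isDominant h, transitions, Finset.image_eq_empty] at he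
  exact absurd (mem_leftCovers.mpr hi) (by simp [he])

theorem leaves_modifiedLSTree_of_isDominant {w : Perm (Fin n)} (h : IsDominant w) :
    (modifiedLSTree w).leaves = {w} := by
  rw [modifiedLSTree, LabelledTree.leaves, if_pos (childLabels_of_isDominant h)]

theorem leaves_modifiedLSTree_of_not_isDominant {w : Perm (Fin n)} (h : ¬ IsDominant w) :
    (modifiedLSTree w).leaves = ∑ v ∈ childLabels w, (modifiedLSTree v).leaves := by
  rw [modifiedLSTree, LabelledTree.leaves, if_neg (childLabels_eq_empty_iff.not.mpr h)]
  exact Finset.sum_coe_sort (childLabels w) fun v => (modifiedLSTree v).leaves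

theorem childLabels_induction {motive : Perm (Fin n) → Prop}
    (dominant : ∀ w, IsDominant w → motive w)
    (step : ∀ w, ¬ IsDominant w → (∀ v ∈ childLabels w, motive v) → motive w)
    (w : Perm (Fin n)) : motive w := by
  have wf : WellFounded fun v w : Perm (Fin n) =>
      toLex (w : Fin n → Fin n) < toLex (v : Fin n → Fin n) :=
    InvImage.wf (fun w : Perm (Fin n) => toLex (w : Fin n → Fin n))
      (wellFounded_gt (α := Lex (Fin n → Fin n)))
  induction w using wf.induction with
  | _ w ih =>
    by_cases h : IsDominant w
    · exact dominant w h
    · exact step w h fun v hv => ih v (lex_lt_of_mem_childLabels hv)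

theorem isDominant_of_mem_leaves (w : Perm (Fin n)) :
    ∀ v ∈ (modifiedLSTree w).leaves, IsDominant v := by
  induction w using childLabels_induction with
  | dominant w h => simp [leaves_modifiedLSTree_of_isDominant h, h]
  | step w h ih =>
    rw [leaves_modifiedLSTree_of_not_isDominant h]
    intro v hv
    obtain ⟨u, hu, hv⟩ := Multiset.mem_sum.mp hv
    exact ih u hu v hv

theorem stanley_eq_sum_leaves (w : Perm (Fin n)) :
    stanley w = ((modifiedLSTree w).leaves.map stanley).sum := by
  induction w using childLabels_induction with
  | dominant w h => simp [leaves_modifiedLSTree_of_isDominant h]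
  | step w h ih =>
    rw [leaves_modifiedLSTree_of_not_isDominant h, stanley_eq_sum_childLabels h,
      Finset.sum_congr rfl ih]
    generalize childLabels w = S
    induction S using Finset.cons_induction with
    | empty => simp
    | cons a S ha ih => rw [Finset.sum_cons, Finset.sum_cons, ih, Multiset.map_add, Multiset.sum_add]

/-! ### Tableaux filled in the order of the pairs of a letter and a variable -/

/-- `(i, j)` is a corner of `μ`: a cell that can be removed. -/
def IsCorner (μ : YoungDiagram) (i j : ℕ) : Prop :=
  (i, j) ∈ μ ∧ (i + 1, j) ∉ μ ∧ (i, j + 1) ∉ μ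

/-- The Young diagram without a corner. -/
def eraseCorner (μ : YoungDiagram) {i j : ℕ} (h : IsCorner μ i j) : YoungDiagram where
  cells := μ.cells.erase (i, j)
  isLowerSet := by
    rintro ⟨a1, a2⟩ ⟨b1, b2⟩ ⟨h1, h2⟩ ha
    simp only [Finset.coe_erase, Set.mem_sdiff, Finset.mem_coe, YoungDiagram.mem_cells,
      Set.mem_singleton_iff, Prod.mk.injEq] at *
    refine ⟨μ.up_left_mem h1 h2 ha.1, ?_⟩
    rintro ⟨rfl, rfl⟩
    by_cases e : a1 = b1
    · exact h.2.2 (μ.up_left_mem h1 (by have := ha.2; omega) ha.1)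
    · exact h.2.1 (μ.up_left_mem (by omega) h2 ha.1)

theorem mem_eraseCorner {μ : YoungDiagram} {i j : ℕ} (h : IsCorner μ i j) (x y : ℕ) :
    (x, y) ∈ eraseCorner μ h ↔ (x, y) ∈ μ ∧ ¬ (x = i ∧ y = j) := by
  rw [← YoungDiagram.mem_cells, eraseCorner, Finset.mem_erase, Ne, Prod.mk.injEq, and_comm,
    YoungDiagram.mem_cells]

theorem insert_eraseCorner {μ : YoungDiagram} {i j : ℕ} (h : IsCorner μ i j) :
    insert (i, j) (eraseCorner μ h).cells = μ.cells :=
  Finset.insert_erase ((YoungDiagram.mem_cells _).mpr h.1)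

theorem notMem_eraseCorner {μ : YoungDiagram} {i j : ℕ} (h : IsCorner μ i j) :
    (i, j) ∉ (eraseCorner μ h).cells :=
  Finset.notMem_erase _ _

/-- The letter attached to a cell of a Young diagram with at most `r` columns. -/
def letter (r i j : ℕ) : ℕ := r - 1 - j + i

/-- The semistandard tableaux for which all pairs of the letter and the entry of a cell are in
`P`. -/
def tableaux (r : ℕ) (P : List (ℕ × ℕ)) (μ : YoungDiagram) : Set (SemistandardYoungTableau μ) :=
  {T | ∀ i j, (i, j) ∈ μ → (letter r i j, T i j) ∈ P}

theorem finite_tableaux (r : ℕ) (P : List (ℕ × ℕ)) (μ : YoungDiagram) :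
    (tableaux r P μ).Finite := by
  have hfin : (Set.pi Set.univ fun _ : μ.cells => {b : ℕ | ∃ a, (a, b) ∈ P}).Finite := by
    refine Set.Finite.pi fun _ => ?_
    refine (List.finite_toSet (P.map Prod.snd)).subset ?_
    rintro b ⟨a, h⟩
    exact List.mem_map.mpr ⟨_, h, rfl⟩
  refine Set.Finite.of_injOn (f := fun T (c : μ.cells) => T c.1.1 c.1.2) ?_ ?_ hfin
  · intro T hT c _
    exact ⟨_, hT _ _ ((YoungDiagram.mem_cells _).mp c.2)⟩
  · intro T _ T' _ h
    ext i j
    by_cases hij : (i, j) ∈ μ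
    · exact congrFun h ⟨(i, j), (YoungDiagram.mem_cells _).mpr hij⟩
    · rw [T.zeros hij, T'.zeros hij]

/-- The exponent of the monomial of a tableau. -/
noncomputable def content {μ : YoungDiagram} (T : SemistandardYoungTableau μ) : ℕ →₀ ℕ :=
  ∑ x ∈ μ.cells, Finsupp.single (T x.1 x.2) 1

/-- The generating function of `tableaux r P μ`. -/
noncomputable def tableauPoly (r : ℕ) (P : List (ℕ × ℕ)) (μ : YoungDiagram) : MvPolynomial ℕ ℤ :=
  ∑ T ∈ (finite_tableaux r P μ).toFinset, MvPolynomial.monomial (content T) 1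

/-- The tableau without the entry in a corner. -/
def eraseEntry {μ : YoungDiagram} {i j : ℕ} (h : IsCorner μ i j) (T : SemistandardYoungTableau μ) :
    SemistandardYoungTableau (eraseCorner μ h) where
  entry x y := if x = i ∧ y = j then 0 else T x y
  row_weak' {x y1 y2} h1 h2 := by
    rw [mem_eraseCorner] at h2
    rw [if_neg h2.2]
    split_ifs
    · exact Nat.zero_le _
    · exact T.row_weak h1 h2.1
  col_strict' {x1 x2 y} h1 h2 := by
    rw [mem_eraseCorner] at h2
    rw [if_neg h2.2, if_neg]
    · exact T.col_strict h1 h2.1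
    · rintro ⟨rfl, rfl⟩
      exact h.2.1 (μ.up_left_mem h1 le_rfl h2.1)
  zeros' {x y} h1 := by
    rw [mem_eraseCorner] at h1
    split_ifs with h2
    · rfl
    · exact T.zeros fun h3 => h1 ⟨h3, h2⟩

/-- The tableau with a new entry in a corner. -/
def insertEntry {μ : YoungDiagram} {i j : ℕ} (h : IsCorner μ i j)
    (T : SemistandardYoungTableau (eraseCorner μ h)) (b : ℕ) (hr : ∀ y < j, T i y ≤ b)
    (hc : ∀ x < i, T x j < b) : SemistandardYoungTableau μ where
  entry x y := if x = i ∧ y = j then b else T x y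
  row_weak' {x y1 y2} h1 h2 := by
    split_ifs with h3 h4 h4
    · exact le_rfl
    · obtain ⟨rfl, rfl⟩ := h3
      exact absurd (μ.up_left_mem le_rfl h1 h2) h.2.2
    · rw [h4.1]; exact hr _ (h4.2 ▸ h1)
    · exact T.row_weak h1 ((mem_eraseCorner h _ _).mpr ⟨h2, h4⟩)
  col_strict' {x1 x2 y} h1 h2 := by
    split_ifs with h3 h4 h4
    · omega
    · obtain ⟨rfl, rfl⟩ := h3
      exact absurd (μ.up_left_mem h1 le_rfl h2) h.2.1
    · rw [h4.2]; exact hc _ (h4.1 ▸ h1)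
    · exact T.col_strict h1 ((mem_eraseCorner h _ _).mpr ⟨h2, h4⟩)
  zeros' {x y} h1 := by
    rw [if_neg]
    · exact T.zeros fun h3 => h1 ((mem_eraseCorner h _ _).mp h3).1
    · rintro ⟨rfl, rfl⟩; exact h1 h.1

theorem eraseEntry_apply {μ : YoungDiagram} {i j : ℕ} (h : IsCorner μ i j)
    (T : SemistandardYoungTableau μ) (x y : ℕ) :
    eraseEntry h T x y = if x = i ∧ y = j then 0 else T x y := rfl

theorem insertEntry_apply {μ : YoungDiagram} {i j : ℕ} (h : IsCorner μ i j)
    (T : SemistandardYoungTableau (eraseCorner μ h)) (b : ℕ) (hr : ∀ y < j, T i y ≤ b)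
    (hc : ∀ x < i, T x j < b) (x y : ℕ) :
    insertEntry h T b hr hc x y = if x = i ∧ y = j then b else T x y := rfl

theorem content_eq_add_eraseEntry {μ : YoungDiagram} {i j : ℕ} (h : IsCorner μ i j)
    (T : SemistandardYoungTableau μ) :
    content T = Finsupp.single (T i j) 1 + content (eraseEntry h T) := by
  unfold content
  rw [← insert_eraseCorner h, Finset.sum_insert (notMem_eraseCorner h)]
  congr 1
  refine Finset.sum_congr rfl fun x hx => ?_
  rw [eraseEntry_apply, if_neg]
  rw [YoungDiagram.mem_cells] at hx
  exact ((mem_eraseCorner h _ _).mp hx).2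

theorem pairLT_of_mem_of_pairwise {P : List (ℕ × ℕ)} {x y : ℕ × ℕ}
    (hP : (P ++ [x]).Pairwise PairLT) (hy : y ∈ P) : PairLT y x :=
  (List.pairwise_append.mp hP).2.2 y hy x (by simp)

/-- The pair `(a, b)` is the largest one available. A cell below would have a larger entry, and a
cell to the right an entry at least `b` with letter `a - 1`; either pair would exceed `(a, b)`. The
bound `j < r` keeps the subtraction in `letter` from truncating. -/
theorem isCorner_of_mem_tableaux {r : ℕ} {P : List (ℕ × ℕ)} {a b : ℕ}
    (hP : (P ++ [(a, b)]).Pairwise PairLT) {μ : YoungDiagram} (hμ : ∀ i j, (i, j) ∈ μ → j < r)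
    {T : SemistandardYoungTableau μ} (hT : T ∈ tableaux r (P ++ [(a, b)]) μ) {i j : ℕ}
    (hij : (i, j) ∈ μ) (ha : letter r i j = a) (hb : T i j = b) : IsCorner μ i j := by
  have key : ∀ x y, (x, y) ∈ μ → PairLT (letter r x y, T x y) (a, b) ∨
      letter r x y = a ∧ T x y = b := fun x y h => by
    rcases List.mem_append.mp (hT x y h) with h | h
    · exact Or.inl (pairLT_of_mem_of_pairwise hP h)
    · simpa using Or.inr (List.mem_singleton.mp h)
  refine ⟨hij, fun h => ?_, fun h => ?_⟩
  · have h1 := T.col_strict (show i < i + 1 by omega) h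
    have h2 := key _ _ h
    simp only [PairLT] at h2
    omega
  · have h1 := T.row_weak (show j < j + 1 by omega) h
    have h2 := key _ _ h
    have h3 := hμ _ _ h
    simp only [PairLT, letter] at *
    omega

/-- The letter is constant on diagonals, and a diagonal contains at most one corner. -/
theorem IsCorner.eq_of_letter_eq {r : ℕ} {μ : YoungDiagram} (hμ : ∀ i j, (i, j) ∈ μ → j < r)
    {i j x y : ℕ} (h : IsCorner μ i j) (h' : IsCorner μ x y) (e : letter r i j = letter r x y) :
    i = x ∧ j = y := by
  have h1 := hμ _ _ h.1
  have h2 := hμ _ _ h'.1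
  unfold letter at e
  rcases lt_trichotomy i x with h3 | h3 | h3
  · exact absurd (μ.up_left_mem h3 (by omega) h'.1) h.2.1
  · omega
  · exact absurd (μ.up_left_mem h3 (by omega) h.1) h'.2.1

theorem tableauPoly_concat_of_not_isCorner {r : ℕ} {P : List (ℕ × ℕ)} {a b : ℕ}
    (hP : (P ++ [(a, b)]).Pairwise PairLT) {μ : YoungDiagram} (hμ : ∀ i j, (i, j) ∈ μ → j < r)
    (h : ∀ i j, letter r i j = a → ¬ IsCorner μ i j) :
    tableauPoly r (P ++ [(a, b)]) μ = tableauPoly r P μ := by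
  unfold tableauPoly
  congr 1
  ext T
  simp only [Set.Finite.mem_toFinset]
  refine ⟨fun hT i j hij => ?_, fun hT i j hij => List.mem_append_left _ (hT i j hij)⟩
  rcases List.mem_append.mp (hT i j hij) with h1 | h1
  · exact h1
  · rw [List.mem_singleton, Prod.mk.injEq] at h1
    exact absurd (isCorner_of_mem_tableaux hP hμ hT hij h1.1 h1.2) (h _ _ h1.1)

/-- A tableau that uses the pair `(a, b)` must have it in the unique corner on the diagonal of `a`,
and is determined by what remains after erasing that corner. -/
theorem tableauPoly_concat_of_isCorner {r : ℕ} {P : List (ℕ × ℕ)} {a b : ℕ}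
    (hP : (P ++ [(a, b)]).Pairwise PairLT) {μ : YoungDiagram} (hμ : ∀ i j, (i, j) ∈ μ → j < r)
    {i j : ℕ} (h : IsCorner μ i j) (ha : letter r i j = a) :
    tableauPoly r (P ++ [(a, b)]) μ =
      tableauPoly r P μ + MvPolynomial.X b * tableauPoly r P (eraseCorner μ h) := by
  classical
  have hnot : (a, b) ∉ P := fun hm => irrefl _ (pairLT_of_mem_of_pairwise hP hm)
  unfold tableauPoly
  rw [← Finset.sum_filter_add_sum_filter_not _ fun T => T ∈ tableaux r P μ, Finset.mul_sum]
  congr 1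
  · refine Finset.sum_congr ?_ fun _ _ => rfl
    ext T
    simp only [Set.Finite.mem_toFinset, Finset.mem_filter]
    exact ⟨fun hT => hT.2, fun hT => ⟨fun i j hij => List.mem_append_left _ (hT i j hij), hT⟩⟩
  · have hmem : ∀ T, T ∈ tableaux r (P ++ [(a, b)]) μ ∧ T ∉ tableaux r P μ →
        T i j = b := fun T ⟨hT, hT'⟩ => by
      unfold tableaux at hT'
      simp only [Set.mem_ofPred_eq, not_forall] at hT'
      obtain ⟨x, y, hxy, h1⟩ := hT'
      have h2 := (List.mem_append.mp (hT x y hxy)).resolve_left h1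
      rw [List.mem_singleton, Prod.mk.injEq] at h2
      have h3 := isCorner_of_mem_tableaux hP hμ hT hxy h2.1 h2.2
      obtain ⟨rfl, rfl⟩ := h.eq_of_letter_eq hμ h3 (ha.trans h2.1.symm)
      exact h2.2
    -- Every pair of `P` precedes `(a, b)`, so all entries are at most `b`; above the corner the
    -- letters are smaller than `a`, which excludes equality.
    have hlt : ∀ T ∈ tableaux r P (eraseCorner μ h), (∀ y < j, T i y ≤ b) ∧ ∀ x < i, T x j < b := by
      intro T hT
      have hjr := hμ _ _ h.1
      refine ⟨fun y hy => ?_, fun x hx => ?_⟩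
      · have := pairLT_of_mem_of_pairwise hP (hT i y
          ((mem_eraseCorner h _ _).mpr ⟨μ.up_left_mem le_rfl hy.le h.1, by omega⟩))
        simp only [PairLT] at this; omega
      · have := pairLT_of_mem_of_pairwise hP (hT x j
          ((mem_eraseCorner h _ _).mpr ⟨μ.up_left_mem hx.le le_rfl h.1, by omega⟩))
        simp only [PairLT, letter] at *; omega
    refine Finset.sum_bij' (fun T _ => eraseEntry h T)
      (fun T hT => insertEntry h T b (hlt T (by simpa using hT)).1 (hlt T (by simpa using hT)).2)
      ?_ ?_ ?_ ?_ ?_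
    · intro T hT
      simp only [Finset.mem_filter, Set.Finite.mem_toFinset] at hT ⊢
      intro x y hxy
      rw [mem_eraseCorner] at hxy
      rw [eraseEntry_apply, if_neg hxy.2]
      refine (List.mem_append.mp (hT.1 x y hxy.1)).resolve_right fun h1 => ?_
      rw [List.mem_singleton, Prod.mk.injEq] at h1
      have h3 := isCorner_of_mem_tableaux hP hμ hT.1 hxy.1 h1.1 h1.2
      obtain ⟨rfl, rfl⟩ := h.eq_of_letter_eq hμ h3 (ha.trans h1.1.symm)
      exact hxy.2 ⟨rfl, rfl⟩
    · intro T hT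
      simp only [Finset.mem_filter, Set.Finite.mem_toFinset] at hT ⊢
      constructor
      · intro x y hxy
        rw [insertEntry_apply]
        split_ifs with h1
        · rw [h1.1, h1.2, ha]; simp
        · exact List.mem_append_left _ (hT x y ((mem_eraseCorner h _ _).mpr ⟨hxy, h1⟩))
      · intro h1
        have := h1 i j h.1
        rw [insertEntry_apply, if_pos ⟨rfl, rfl⟩, ha] at this
        exact hnot this
    · intro T hT
      simp only [Finset.mem_filter, Set.Finite.mem_toFinset] at hT
      ext x y
      rw [insertEntry_apply, eraseEntry_apply]
      split_ifs with h1
      · rw [h1.1, h1.2, hmem T hT]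
      · rfl
    · intro T hT
      ext x y
      rw [eraseEntry_apply, insertEntry_apply]
      split_ifs with h1
      · exact (T.zeros fun h2 => ((mem_eraseCorner h _ _).mp h2).2 h1).symm
      · rfl
    · intro T hT
      simp only [Finset.mem_filter, Set.Finite.mem_toFinset] at hT
      rw [content_eq_add_eraseEntry h T, hmem T hT, MvPolynomial.X, MvPolynomial.monomial_mul,
        one_mul]

theorem schur_apply {μ : YoungDiagram} {r N m : ℕ}
    (hμ : ∀ i j, (i, j) ∈ μ → letter r i j < N) (d : ℕ →₀ ℕ)
    (hd : ∀ b ∈ d.support, b < m) :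
    schur μ d = MvPolynomial.coeff d (tableauPoly r (blocks N (List.range m)) μ) := by
  classical
  unfold tableauPoly schur
  simp only [MvPolynomial.coeff_sum, MvPolynomial.coeff_monomial, Finset.sum_boole, Nat.cast_inj]
  rw [← Set.ncard_coe_finset]
  congr 1
  ext T
  simp only [Set.mem_ofPred_eq, Finset.coe_filter, Set.Finite.mem_toFinset]
  refine ⟨fun h => ⟨fun i j hij => ?_, h⟩, fun h => h.2⟩
  refine mem_blocks.mpr ⟨hμ i j hij, List.mem_range.mpr (hd _ ?_)⟩
  rw [Finsupp.mem_support_iff, ← h, Finsupp.finsetSum_apply]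
  refine (Finset.sum_pos' (fun _ _ => Nat.zero_le _) ⟨(i, j), (YoungDiagram.mem_cells _).mpr hij, ?_⟩).ne'
  simp

/-! ### Inverse Grassmannian permutations -/

open Classical in
/-- The operator on functions of permutations dual to right multiplication in the nilCoxeter
algebra. -/
noncomputable def rightOp {R : Type*} [Zero R] (a : ℕ) (f : Perm (Fin n) → R) (w : Perm (Fin n)) :
    R :=
  if RightDescent w a then f (w * adjSwap n a) else 0

theorem rightDescent_iff_length {w : Perm (Fin n)} {a : ℕ} (h1 : a + 1 < n) :
    RightDescent w a ↔ length w = length (w * adjSwap n a) + 1 := by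
  refine ⟨RightDescent.length_eq, fun h => ?_⟩
  by_contra hd
  have := (rightDescent_mul_adjSwap h1 hd).length_eq
  rw [mul_assoc, adjSwap_mul_self, mul_one] at this
  omega

/-- Both sides say that `s_a w s_b` is shorter than `w` by two. -/
theorem leftDescent_and_rightDescent_iff {w : Perm (Fin n)} {a b : ℕ} :
    LeftDescent w a ∧ RightDescent (adjSwap n a * w) b ↔
      RightDescent w b ∧ LeftDescent (w * adjSwap n b) a := by
  by_cases h : a + 1 < n ∧ b + 1 < n
  · rw [leftDescent_iff_length h.1, rightDescent_iff_length h.2, rightDescent_iff_length h.2,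
      leftDescent_iff_length h.1, ← mul_assoc]
    have h1 := length_adjSwap_mul_le (adjSwap n a * w) a
    have h2 := length_mul_adjSwap_le (adjSwap n a * w * adjSwap n b) b
    have h3 := length_mul_adjSwap_le (w * adjSwap n b) b
    have h4 := length_adjSwap_mul_le (adjSwap n a * w * adjSwap n b) a
    simp only [← mul_assoc, adjSwap_mul_self, one_mul] at h1 h4
    simp only [mul_assoc, adjSwap_mul_self, mul_one] at *
    omega
  · exact ⟨fun h' => absurd ⟨h'.1.1, h'.2.1⟩ h, fun h' => absurd ⟨h'.2.1, h'.1.1⟩ h⟩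

theorem leftOp_rightOp {R : Type*} [Zero R] (a b : ℕ) (f : Perm (Fin n) → R) (w : Perm (Fin n)) :
    leftOp a (rightOp b f) w = rightOp b (leftOp a f) w := by
  have := leftDescent_and_rightDescent_iff (w := w) (a := a) (b := b)
  unfold leftOp rightOp
  rw [← ite_and, ← ite_and, mul_assoc]
  split_ifs with h1 h2 h2
  · rfl
  · exact absurd (this.mp h1) h2
  · exact absurd (this.mpr h2) h1
  · rfl

theorem rightDescent_iff_leftDescent_one {w : Perm (Fin n)} {a : ℕ} :
    LeftDescent w a ∧ adjSwap n a * w = 1 ↔ RightDescent w a ∧ w * adjSwap n a = 1 := by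
  have e : adjSwap n a * w = 1 ↔ w = adjSwap n a := by
    rw [mul_eq_one_iff_eq_inv', adjSwap_inv]
  have e' : w * adjSwap n a = 1 ↔ w = adjSwap n a := by
    rw [mul_eq_one_iff_eq_inv, adjSwap_inv]
  rw [e, e']
  refine and_congr_left fun h => ?_
  subst h
  unfold LeftDescent RightDescent
  rw [adjSwap_symm]

/-- The list is read from the left in the definition of `redPoly`; since `leftOp` and `rightOp`
commute, it can equally be read from the right, which is the order in which corners are removed from
a tableau. -/
theorem redPoly_concat (P : List (ℕ × ℕ)) (a b : ℕ) (w : Perm (Fin n)) :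
    redPoly (P ++ [(a, b)]) w = redPoly P w + MvPolynomial.X b * rightOp a (redPoly P) w := by
  induction P generalizing w with
  | nil =>
    change redPoly [] w + MvPolynomial.X b * leftOp a (redPoly []) w = _
    congr 2
    unfold leftOp rightOp redPoly
    rw [← ite_and, ← ite_and]
    split_ifs with h1 h2 h2
    · rfl
    · exact absurd (rightDescent_iff_leftDescent_one.mp h1) h2
    · exact absurd (rightDescent_iff_leftDescent_one.mpr h2) h1
    · rfl
  | cons x P ih =>
    have e : redPoly (P ++ [(a, b)]) =
        fun w : Perm (Fin n) => redPoly P w + MvPolynomial.X b * rightOp a (redPoly P) w :=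
      funext ih
    have h1 : leftOp x.1 (redPoly (P ++ [(a, b)])) w = leftOp x.1 (redPoly P) w +
        MvPolynomial.X b * leftOp x.1 (rightOp a (redPoly P)) w := by
      rw [e]; unfold leftOp; split_ifs <;> simp
    have h2 : rightOp a (redPoly (x :: P)) w = rightOp a (redPoly P) w +
        MvPolynomial.X x.2 * rightOp a (leftOp x.1 (redPoly P)) w := by
      unfold rightOp; split_ifs <;> simp [redPoly]
    rw [List.cons_append, redPoly, h1, h2, ih, leftOp_rightOp, redPoly]
    ring

/-- The position of the value `v` in the inverse Grassmannian permutation of shape `μ`, for which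
the values below `r` and the values from `r` on appear in increasing order. -/
def grassPos (r : ℕ) (μ : YoungDiagram) (v : ℕ) : ℕ :=
  if v < r then v + μ.colLen (r - 1 - v) else v - μ.rowLen (v - r)

/-- `w` is the inverse Grassmannian permutation of shape `μ`. -/
structure IsGrass (w : Perm (Fin n)) (r : ℕ) (μ : YoungDiagram) : Prop where
  le : r ≤ n
  mem_box : ∀ i j, (i, j) ∈ μ → j < r ∧ r + i < n
  symm_val : ∀ v : Fin n, (w.symm v : ℕ) = grassPos r μ v

theorem rowLen_le_of_box {μ : YoungDiagram} {r : ℕ} (h : ∀ i j, (i, j) ∈ μ → j < r) (i : ℕ) :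
    μ.rowLen i ≤ r := by
  by_contra h1
  exact absurd (h i r (YoungDiagram.mem_iff_lt_rowLen.mpr (by omega))) (lt_irrefl r)

theorem rowLen_add_colLen_of_mem {μ : YoungDiagram} {i j : ℕ} (h : (i, j) ∈ μ) :
    i + j + 2 ≤ μ.rowLen i + μ.colLen j := by
  have h1 := YoungDiagram.mem_iff_lt_rowLen.mp h
  have h2 := YoungDiagram.mem_iff_lt_colLen.mp h
  omega

theorem rowLen_add_colLen_of_notMem {μ : YoungDiagram} {i j : ℕ} (h : (i, j) ∉ μ) :
    μ.rowLen i + μ.colLen j ≤ i + j := by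
  rw [YoungDiagram.mem_iff_lt_rowLen] at h
  have h2 : ¬ i < μ.colLen j := fun h' =>
    h (YoungDiagram.mem_iff_lt_rowLen.mp (YoungDiagram.mem_iff_lt_colLen.mpr h'))
  omega

theorem exists_isGrass {r s : ℕ} {μ : YoungDiagram} (h : ∀ i j, (i, j) ∈ μ → j < r ∧ i < s) :
    ∃ w : Perm (Fin (r + s)), IsGrass w r μ := by
  have hrow := rowLen_le_of_box fun i j hij => (h i j hij).1
  have hcol : ∀ j, μ.colLen j ≤ s := fun j => by
    by_contra h1
    exact absurd (h s j (YoungDiagram.mem_iff_lt_colLen.mpr (by omega))).2 (lt_irrefl s)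
  have hlt : ∀ v : Fin (r + s), grassPos r μ v < r + s := fun v => by
    have := v.2
    have := hcol (r - 1 - v)
    unfold grassPos
    split_ifs <;> omega
  have hinj : Function.Injective fun v : Fin (r + s) => (⟨grassPos r μ v, hlt v⟩ : Fin (r + s)) := by
    have key : ∀ v w : ℕ, v < w → grassPos r μ v ≠ grassPos r μ w := by
      intro v w hvw
      unfold grassPos
      have h1 := hrow (w - r)
      have h3 := hrow (v - r)
      split_ifs with c1 c2 c2
      · have := μ.colLen_anti (r - 1 - w) (r - 1 - v) (by omega)
        omega
      -- With `i = w - r` and `j = r - 1 - v`, equal positions would mean `rowLen i + colLen j = i +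
      -- j + 1`. This sum is at least `i + j + 2` for cells of `μ` and at most `i + j` for all
      -- others.
      · by_cases hm : (w - r, r - 1 - v) ∈ μ
        · have := rowLen_add_colLen_of_mem hm; omega
        · have := rowLen_add_colLen_of_notMem hm; omega
      · omega
      · have := μ.rowLen_anti (v - r) (w - r) (by omega)
        omega
    intro v w hvw
    rw [Fin.mk.injEq] at hvw
    by_contra hne
    rcases lt_or_gt_of_ne (Fin.val_injective.ne hne) with h1 | h1
    · exact key _ _ h1 hvw
    · exact key _ _ h1 hvw.symm
  refine ⟨(Equiv.ofBijective _ (Finite.injective_iff_bijective.mp hinj)).symm, by omega,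
    fun i j hij => ⟨(h i j hij).1, by have := (h i j hij).2; omega⟩, fun v => rfl⟩

theorem IsCorner.rowLen_eq {μ : YoungDiagram} {i j : ℕ} (h : IsCorner μ i j) :
    μ.rowLen i = j + 1 := by
  have h1 := YoungDiagram.mem_iff_lt_rowLen.mp h.1
  have h2 := YoungDiagram.mem_iff_lt_rowLen.not.mp h.2.2
  omega

theorem IsCorner.colLen_eq {μ : YoungDiagram} {i j : ℕ} (h : IsCorner μ i j) :
    μ.colLen j = i + 1 := by
  have h1 := YoungDiagram.mem_iff_lt_colLen.mp h.1
  have h2 := YoungDiagram.mem_iff_lt_colLen.not.mp h.2.1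
  omega

theorem eq_of_forall_lt_iff {x y : ℕ} (h : ∀ k, k < x ↔ k < y) : x = y := by
  have h1 := h x
  have h2 := h y
  omega

theorem rowLen_eraseCorner {μ : YoungDiagram} {i j : ℕ} (h : IsCorner μ i j) (x : ℕ) :
    (eraseCorner μ h).rowLen x = if x = i then j else μ.rowLen x := by
  refine eq_of_forall_lt_iff fun k => ?_
  rw [← YoungDiagram.mem_iff_lt_rowLen, mem_eraseCorner, YoungDiagram.mem_iff_lt_rowLen]
  split_ifs with hx
  · subst hx; rw [h.rowLen_eq]; omega
  · simp [hx]

theorem colLen_eraseCorner {μ : YoungDiagram} {i j : ℕ} (h : IsCorner μ i j) (y : ℕ) :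
    (eraseCorner μ h).colLen y = if y = j then i else μ.colLen y := by
  refine eq_of_forall_lt_iff fun k => ?_
  rw [← YoungDiagram.mem_iff_lt_colLen, mem_eraseCorner, YoungDiagram.mem_iff_lt_colLen]
  split_ifs with hx
  · subst hx; rw [h.colLen_eq]; omega
  · simp [hx]

/-- For a corner `(i, j)` the values `r + i` and `r - 1 - j` stand in the adjacent positions `letter
r i j` and `letter r i j + 1`. Exchanging them shortens row `i` and column `j` by one. -/
theorem IsGrass.rightDescent {w : Perm (Fin n)} {r : ℕ} {μ : YoungDiagram} (hw : IsGrass w r μ)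
    {i j : ℕ} (h : IsCorner μ i j) : RightDescent w (letter r i j) ∧
      IsGrass (w * adjSwap n (letter r i j)) r (eraseCorner μ h) := by
  obtain ⟨hj, hi⟩ := hw.mem_box i j h.1
  have h1 : letter r i j + 1 < n := by unfold letter; omega
  have e1 : (w.symm ⟨r + i, hi⟩ : ℕ) = letter r i j := by
    rw [hw.symm_val, grassPos, if_neg (by simp), letter]
    simp only [Nat.add_sub_cancel_left, h.rowLen_eq]
    omega
  have hr : r - 1 - (r - 1 - j) = j := by omega
  have e2 : (w.symm ⟨r - 1 - j, by omega⟩ : ℕ) = letter r i j + 1 := by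
    rw [hw.symm_val, grassPos, if_pos (by simp; omega), letter]
    simp only [hr, h.colLen_eq]
    omega
  refine ⟨⟨h1, ?_⟩, hw.le, fun x y hxy => hw.mem_box x y ((mem_eraseCorner h x y).mp hxy).1,
    fun v => ?_⟩
  · rw [show (⟨letter r i j + 1, h1⟩ : Fin n) = w.symm ⟨r - 1 - j, by omega⟩ from Fin.ext e2.symm,
      show (⟨letter r i j, by omega⟩ : Fin n) = w.symm ⟨r + i, hi⟩ from Fin.ext e1.symm,
      apply_symm_apply, apply_symm_apply, Fin.mk_lt_mk]
    omega
  · have e3 : (w * adjSwap n (letter r i j)).symm = adjSwap n (letter r i j) * w.symm := by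
      rw [← Perm.inv_def, mul_inv_rev, adjSwap_inv, Perm.inv_def]
    rw [e3, Perm.mul_apply, val_adjSwap h1]
    have i1 : (w.symm v : ℕ) = letter r i j ↔ (v : ℕ) = r + i := by
      rw [← e1, Fin.val_inj, w.symm.injective.eq_iff, Fin.ext_iff]
    have i2 : (w.symm v : ℕ) = letter r i j + 1 ↔ (v : ℕ) = r - 1 - j := by
      rw [← e2, Fin.val_inj, w.symm.injective.eq_iff, Fin.ext_iff]
    rw [if_congr i1 rfl (if_congr i2 rfl rfl), hw.symm_val]
    simp only [grassPos, rowLen_eraseCorner, colLen_eraseCorner, letter]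
    split_ifs <;> omega

theorem IsGrass.exists_isCorner {w : Perm (Fin n)} {r : ℕ} {μ : YoungDiagram}
    (hw : IsGrass w r μ) {a : ℕ} (h : RightDescent w a) :
    ∃ i j, letter r i j = a ∧ IsCorner μ i j := by
  obtain ⟨h1, h2⟩ := h
  have hrow := rowLen_le_of_box fun i j hij => (hw.mem_box i j hij).1
  have e1 := hw.symm_val (w ⟨a, by omega⟩)
  have e2 := hw.symm_val (w ⟨a + 1, h1⟩)
  rw [symm_apply_apply] at e1 e2
  rw [Fin.lt_def] at h2
  generalize ((w ⟨a, _⟩ : Fin n) : ℕ) = x at *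
  generalize ((w ⟨a + 1, _⟩ : Fin n) : ℕ) = y at *
  simp only [grassPos] at e1 e2
  have h3 := hrow (x - r)
  have h4 := hrow (y - r)
  split_ifs at e1 e2 with c1 c2 c2
  · have := μ.colLen_anti (r - 1 - x) (r - 1 - y) (by omega)
    omega
  · omega
  -- The values in the two adjacent positions force row length plus column length to be `i + j + 2`,
  -- the least value possible for a cell `(i, j)` of `μ`; so this cell ends its row and its column.
  · have hm : (x - r, r - 1 - y) ∈ μ := by
      by_contra hm
      have := rowLen_add_colLen_of_notMem hm
      omega
    have l1 := YoungDiagram.mem_iff_lt_rowLen.mp hm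
    have l2 := YoungDiagram.mem_iff_lt_colLen.mp hm
    refine ⟨x - r, r - 1 - y, by unfold letter; omega, hm, fun h => ?_, fun h => ?_⟩
    · have := YoungDiagram.mem_iff_lt_colLen.mp h; omega
    · have := YoungDiagram.mem_iff_lt_rowLen.mp h; omega
  · have := μ.rowLen_anti (y - r) (x - r) (by omega)
    omega

theorem IsGrass.eq_one_iff {w : Perm (Fin n)} {r : ℕ} {μ : YoungDiagram} (hw : IsGrass w r μ) :
    w = 1 ↔ μ.cells = ∅ := by
  constructor
  · rintro rfl
    refine Finset.eq_empty_of_forall_notMem fun ⟨i, j⟩ hij => ?_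
    rw [YoungDiagram.mem_cells] at hij
    obtain ⟨h1, h2⟩ := hw.mem_box i j hij
    have h3 := hw.symm_val ⟨r + i, h2⟩
    have h4 := YoungDiagram.mem_iff_lt_rowLen.mp hij
    rw [grassPos, if_neg (by simp)] at h3
    simp only [Nat.add_sub_cancel_left] at h3
    change r + i = _ at h3
    omega
  · intro h
    have hn : ∀ i j, (i, j) ∉ μ := fun i j hij => by
      rw [← YoungDiagram.mem_cells, h] at hij; simp at hij
    have h1 : w.symm = 1 := by
      ext v
      have h2 := hn (v - r) 0
      have h3 := hn 0 (r - 1 - v)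
      rw [YoungDiagram.mem_iff_lt_rowLen] at h2
      rw [YoungDiagram.mem_iff_lt_colLen] at h3
      rw [hw.symm_val, grassPos, Perm.one_apply]
      split_ifs <;> omega
    rwa [← Perm.inv_def, inv_eq_one] at h1

/-- Right descents of an inverse Grassmannian permutation correspond to corners of its shape, so
`redPoly_concat` and the recursion for `tableauPoly` agree term by term. -/
theorem redPoly_eq_tableauPoly {r : ℕ} (P : List (ℕ × ℕ)) (hP : P.Pairwise PairLT)
    {w : Perm (Fin n)} {μ : YoungDiagram} (hw : IsGrass w r μ) :
    redPoly P w = tableauPoly r P μ := by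
  classical
  induction P using List.reverseRecOn generalizing w μ with
  | nil =>
    rw [redPoly, if_congr hw.eq_one_iff rfl rfl, tableauPoly]
    split_ifs with h
    · have hn : ∀ i j, (i, j) ∉ μ := fun i j hij => by
        rw [← YoungDiagram.mem_cells, h] at hij; simp at hij
      have hT : ∀ T T' : SemistandardYoungTableau μ, T = T' := fun T T' => by
        ext i j; rw [T.zeros (hn i j), T'.zeros (hn i j)]
      rw [Finset.sum_eq_single (default : SemistandardYoungTableau μ)]
      · simp [content, h]
      · exact fun T _ hne => absurd (hT _ _) hne
      · intro hd
        exact absurd ((finite_tableaux r [] μ).mem_toFinset.mpr fun i j hij => absurd hij (hn i j)) hd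
    · symm
      refine Finset.sum_eq_zero fun T hT => ?_
      obtain ⟨⟨i, j⟩, hij⟩ := Finset.nonempty_iff_ne_empty.mpr h
      have := (finite_tableaux r [] μ).mem_toFinset.mp hT i j ((YoungDiagram.mem_cells _).mp hij)
      simp at this
  | append_singleton P x ih =>
    obtain ⟨a, b⟩ := x
    have hP' := (List.pairwise_append.mp hP).1
    have hbox := fun i j hij => (hw.mem_box i j hij).1
    rw [redPoly_concat, ih hP' hw]
    by_cases h : ∃ i j, letter r i j = a ∧ IsCorner μ i j
    · obtain ⟨i, j, rfl, hc⟩ := h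
      obtain ⟨h1, h2⟩ := hw.rightDescent hc
      rw [rightOp, if_pos h1, ih hP' h2, tableauPoly_concat_of_isCorner hP hbox hc rfl]
    · rw [rightOp, if_neg fun hd => h (hw.exists_isCorner hd), mul_zero, add_zero,
        tableauPoly_concat_of_not_isCorner hP hbox fun i j h1 h2 => h ⟨i, j, h1, h2⟩]

theorem exists_bound (d : ℕ →₀ ℕ) : ∃ m, ∀ b ∈ d.support, b < m :=
  ⟨d.support.sup id + 1, fun _ hb => Nat.lt_succ_of_le (Finset.le_sup (f := id) hb)⟩

theorem IsGrass.stanley_eq {w : Perm (Fin n)} {r : ℕ} {μ : YoungDiagram} (hw : IsGrass w r μ) :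
    stanley w = schur μ := by
  funext d
  obtain ⟨m, hm⟩ := exists_bound d
  rw [stanley_apply w le_rfl d hm, schur_apply (r := r) (N := n - 1) _ d hm,
    redPoly_eq_tableauPoly _ (pairwise_blocks _ _) hw]
  intro i j hij
  have := hw.mem_box i j hij
  unfold letter
  omega

/-! ### Vexillary permutations -/

/-- `w` avoids the pattern 2143. -/
def IsVexillary (w : Perm (Fin n)) : Prop :=
  ∀ a b c d, a < b → b < c → c < d → w b < w a → w a < w d → ¬ w d < w c

/-- The multiset of the entries of the Lehmer code. -/
def codeMultiset (w : Perm (Fin n)) : Multiset ℕ :=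
  Finset.univ.val.map (lehmerCode w)

/-- The relative positions and values of the entries of a vexillary permutation `w` and of the
entries in positions `i < p < q` that are permuted in passing to the child of `w`. -/
structure IsVexillaryStep (w : Perm (Fin n)) (i p q : Fin n) : Prop where
  lt_p : i < p
  lt_q : p < q
  val_lt_q : w i < w q
  val_lt_p : w q < w p
  left : ∀ s, s < i → w s < w i ∨ w q < w s
  middle_left : ∀ s, i < s → s < p → w q < w s
  middle_right : ∀ s, p < s → s < q → w s < w q
  right : ∀ s, q < s → w p < w s ∨ ∀ t, t < p → w s < w t

/-- The conditions on `left` and part of `middle_left` hold because a violation would complete a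
2143 pattern ending in positions `p`, `q`. The rest of `middle_left` is the cover condition,
`middle_right` is the maximality of `p`, and `right` is the maximality of `q`. -/
theorem IsVexillary.step {w : Perm (Fin n)} (hw : IsVexillary w) {i p q : Fin n}
    (h : IsPivot w p q) (hc : Cover (w * swap p q) i p) : IsVexillaryStep w i p q := by
  have hip := hc.1
  have hpq := h.lt
  have e1 : ∀ s, s < p → (w * swap p q) s = w s := fun s hs => by
    rw [Perm.mul_apply, swap_apply_of_ne_of_ne hs.ne (hs.trans hpq).ne]
  have e2 : (w * swap p q) p = w q := by simp
  have hiq : w i < w q := by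
    have := hc.2.1
    rwa [e1 i hip, e2] at this
  refine ⟨hip, hpq, hiq, h.val_lt, fun s hs => ?_, fun s h1 h2 => ?_, fun s h1 h2 => ?_,
    fun s hs => ?_⟩
  · by_contra! hcon
    exact hw s i p q hs hip hpq (lt_of_le_of_ne hcon.1 (w.injective.ne hs.ne'))
      (lt_of_le_of_ne hcon.2 (w.injective.ne (hs.trans (hip.trans hpq)).ne)) h.val_lt
  · rcases lt_or_gt_of_ne (w.injective.ne h1.ne) with h3 | h3
    · have := hc.2.2 s h1 h2
      rw [e1 i hip, e1 s h2, e2] at this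
      exact this h3
    · exact absurd h.val_lt (hw i s p q h1 h2 hpq h3 hiq)
  · by_contra h3
    exact absurd (h.le_left i s q (hip.trans h1) h2 hiq
      (lt_of_le_of_ne (not_lt.mp h3) (w.injective.ne h2.ne'))) (not_le.mpr h1)
  · by_contra! hcon
    obtain ⟨h1, t, h2, h3⟩ := hcon
    have hps := hpq.trans hs
    exact absurd (h.le_right t s hps (lt_of_le_of_ne h1 (w.injective.ne hps.ne')) h2
      (lt_of_le_of_ne h3 (w.injective.ne (h2.trans hps).ne))) (not_le.mpr hs)

theorem IsVexillaryStep.apply {w : Perm (Fin n)} {i p q : Fin n} (h : IsVexillaryStep w i p q)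
    (x : Fin n) : ((x : ℕ) = i ∧ (w * swap p q * swap i p) x = w q) ∨
      ((x : ℕ) = p ∧ (w * swap p q * swap i p) x = w i) ∨
      ((x : ℕ) = q ∧ (w * swap p q * swap i p) x = w p) ∨
      ((x : ℕ) ≠ i ∧ (x : ℕ) ≠ p ∧ (x : ℕ) ≠ q ∧ (w * swap p q * swap i p) x = w x) := by
  have h1 := h.lt_p.ne
  have h2 := h.lt_q.ne
  have h3 := (h.lt_p.trans h.lt_q).ne
  simp only [Fin.val_inj, Perm.mul_apply]
  by_cases e1 : x = i
  · subst e1; simp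
  by_cases e2 : x = p
  · subst e2; simp [swap_apply_of_ne_of_ne h1 h3]
  by_cases e3 : x = q
  · subst e3; simp [swap_apply_of_ne_of_ne e1 e2]
  · simp [Fin.val_inj, e1, e2, e3, swap_apply_of_ne_of_ne e1 e2, swap_apply_of_ne_of_ne e2 e3]

theorem IsVexillaryStep.cases {w : Perm (Fin n)} {i p q : Fin n} (h : IsVexillaryStep w i p q)
    {v : Perm (Fin n)} (hv : v = w * swap p q * swap i p) (x : Fin n) :
    ((x : ℕ) < i ∧ (v x : ℕ) = w x ∧ ((w x : ℕ) < w i ∨ (w q : ℕ) < w x)) ∨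
    ((x : ℕ) = i ∧ (v x : ℕ) = w q) ∨
    ((i : ℕ) < x ∧ (x : ℕ) < p ∧ (v x : ℕ) = w x ∧ (w q : ℕ) < w x) ∨
    ((x : ℕ) = p ∧ (v x : ℕ) = w i) ∨
    ((p : ℕ) < x ∧ (x : ℕ) < q ∧ (v x : ℕ) = w x ∧ (w x : ℕ) < w q) ∨
    ((x : ℕ) = q ∧ (v x : ℕ) = w p) ∨
    ((q : ℕ) < x ∧ (v x : ℕ) = w x ∧ ((w p : ℕ) < w x ∨ (w x : ℕ) < w i)) := by
  have h1 := h.apply x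
  rw [← hv] at h1
  have h2 := h.left x
  have h3 := h.middle_left x
  have h4 := h.middle_right x
  have h5 := fun hx => (h.right x hx).imp_right fun h' => h' i h.lt_p
  have h6 := h.lt_p
  have h7 := h.lt_q
  simp only [Fin.lt_def, Fin.ext_iff] at *
  rcases h1 with h1 | h1 | h1 | h1
  · exact Or.inr (Or.inl h1)
  · exact Or.inr (Or.inr (Or.inr (Or.inl h1)))
  · exact Or.inr (Or.inr (Or.inr (Or.inr (Or.inr (Or.inl h1)))))
  · omega

/-- The child differs from `w` by cyclically moving the values in positions `i`, `p`, `q`. According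
to where the positions of a 2143 pattern in the child lie relative to these three, the pattern is
either impossible or becomes one of `w` after some of its positions are replaced by `i`, `p` or `q`.
-/
theorem IsVexillaryStep.isVexillary {w : Perm (Fin n)} (hw : IsVexillary w) {i p q : Fin n}
    (h : IsVexillaryStep w i p q) : IsVexillary (w * swap p q * swap i p) := by
  obtain ⟨v, hv⟩ : ∃ v, v = w * swap p q * swap i p := ⟨_, rfl⟩
  have hcase := h.cases hv
  rw [← hv]
  intro a b c d hab hbc hcd hba had hdc
  have hip := h.lt_p
  have hpq := h.lt_q
  have hLM := h.val_lt_q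
  have hMH := h.val_lt_p
  have ga := hcase a
  have gb := hcase b
  have gc := hcase c
  have gd := hcase d
  -- An entry right of `q` and below `w i` is smaller than everything to the left of `p`, so the `1`
  -- and `2` of the pattern cannot lie there. This is the only use of the quantifier over `t` in
  -- `right`.
  have hr : q < d → w d < w i → p < a := by
    intro hd hdi
    have h1 : ∀ t, t < p → w d < w t := by
      rcases h.right d hd with h1 | h1
      · exact absurd (hdi.trans (hLM.trans hMH)) (not_lt.mpr h1.le)
      · exact h1
    have h3 := h1 a
    clear h1 hcase gb gc hw h hv
    simp only [Fin.lt_def] at *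
    omega
  clear hcase h
  unfold IsVexillary at hw
  simp only [Fin.lt_def] at *
  have V : ∀ x y z t : Fin n, (x : ℕ) < y ∧ (y : ℕ) < z ∧ (z : ℕ) < t ∧ (w y : ℕ) < w x ∧
      (w x : ℕ) < w t ∧ (w t : ℕ) < w z → False := fun x y z t h =>
    hw x y z t h.1 h.2.1 h.2.2.1 h.2.2.2.1 h.2.2.2.2.1 h.2.2.2.2.2
  clear hw hv
  rcases gd with gd | gd | gd | gd | gd | gd | gd
  · clear hr
    obtain ⟨-, gc, -⟩ | gc := gc
    · obtain ⟨-, gb, -⟩ | gb := gb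
      · obtain ⟨-, ga, -⟩ | ga := ga
        · exact V a b c d (by omega)
        · omega
      · clear ga; omega
    · clear ga gb; omega
  · clear hr
    obtain ⟨-, gc, -⟩ | gc := gc
    · obtain ⟨-, gb, -⟩ | gb := gb
      · obtain ⟨-, ga, -⟩ | ga := ga
        · exact V a b c q (by omega)
        · omega
      · clear ga; omega
    · clear ga gb; omega
  all_goals
    rcases gc with gc | gc | gc | gc | gc | gc | gc
    all_goals first
      | (clear ga gb; omega)
      | (rcases gb with gb | gb | gb | gb | gb | gb | gb
         all_goals first
          | (clear ga; omega)
          | (rcases ga with ga | ga | ga | ga | ga | ga | ga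
             all_goals first
              | omega
              | exact V a b c d (by omega)
              | exact V a i c d (by omega)
              | exact V a b q d (by omega)
              | exact V a b c i (by omega)
              | exact V a b p q (by omega)
              | exact V a b c q (by omega)
              | exact V i b c d (by omega)
              | exact V a b i d (by omega)
              | exact V a b p d (by omega)
              | exact V a i c p (by omega)
              | exact V a b c p (by omega)
              | exact V p q c d (by omega)))

/-- The two code entries in positions `i` and `p` are exchanged and the others are kept. In each
case a permutation of positions carries the inversions counted in the child to those counted in `w`.
-/
theorem IsVexillaryStep.lehmerCode_eq {w : Perm (Fin n)} {i p q : Fin n}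
    (h : IsVexillaryStep w i p q) (x : Fin n) :
    lehmerCode (w * swap p q * swap i p) x = lehmerCode w (swap i p x) := by
  obtain ⟨v, hv⟩ : ∃ v, v = w * swap p q * swap i p := ⟨_, rfl⟩
  have hcase := h.cases hv
  rw [← hv]
  have hip := h.lt_p
  have hpq := h.lt_q
  have hLM := h.val_lt_q
  have hMH := h.val_lt_p
  have hsw : ∀ j : Fin n, ((j : ℕ) = p ∧ swap p q j = q) ∨ ((j : ℕ) = q ∧ swap p q j = p) ∨
      ((j : ℕ) ≠ p ∧ (j : ℕ) ≠ q ∧ swap p q j = j) := fun j => by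
    simp only [Fin.val_inj, swap_apply_def, Ne]
    by_cases h1 : j = p
    · simp [h1]
    by_cases h2 : j = q <;> simp [h1, h2, hpq.ne']
  have hcx := hcase x
  have hval : ∀ y z : Fin n, (y : ℕ) = z → (w y : ℕ) = w z := fun y z hyz => by
    rw [Fin.ext hyz]
  have hxq := hval x q
  unfold lehmerCode
  by_cases hxi : x = i
  · subst hxi
    rw [swap_apply_left]
    -- Nothing between `i` and `p` lies below the new entry `w q`; the inversion with position `p`
    -- in the child takes the place of the inversion of `p` with `q` in `w`.
    refine Finset.card_equiv (swap p q) fun j => ?_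
    have hj := hcase j
    have hji := hval j x
    have hjp := hval j p
    have hjq := hval j q
    clear hval
    simp only [Finset.mem_filter, Finset.mem_univ, true_and, Fin.lt_def] at *
    rcases hsw j with h1 | h1 | h1 <;> simp only [h1.1, h1.2] <;> clear hsw hcase <;> omega
  by_cases hxp : x = p
  · subst hxp
    rw [swap_apply_right]
    refine Finset.card_equiv (Equiv.refl _) fun j => ?_
    have hj := hcase j
    have hji := hval j i
    have hjp := hval j x
    have hjq := hval j q
    clear hval
    simp only [Finset.mem_filter, Finset.mem_univ, true_and, Fin.lt_def, Equiv.refl_apply] at *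
    rcases hsw j with h1 | h1 | h1 <;> clear hsw hcase <;> omega
  rw [swap_apply_of_ne_of_ne hxi hxp]
  rw [← Ne, ← Fin.val_ne_iff] at hxi hxp
  by_cases hx : x < i
  -- The entry in position `x` is unchanged and the values to its right are merely rearranged.
  · refine Finset.card_equiv (swap p q * swap i p) fun j => ?_
    have hj := h.apply j
    have hvj : v j = w ((swap p q * swap i p) j) := by rw [hv]; rfl
    have hlt : x < (swap p q * swap i p) j ↔ x < j := by
      rw [Perm.mul_apply]
      simp only [swap_apply_def, Fin.lt_def, Fin.ext_iff] at *
      split_ifs <;> omega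
    simp only [Finset.mem_filter, Finset.mem_univ, true_and, hvj, hlt]
    rw [show v x = w x from Fin.ext (by rw [Fin.lt_def] at *; omega)]
  by_cases hx' : x < p
  · refine Finset.card_equiv (swap p q) fun j => ?_
    have hj := hcase j
    have hji := hval j i
    have hjp := hval j p
    have hjq := hval j q
    clear hval
    simp only [Finset.mem_filter, Finset.mem_univ, true_and, Fin.lt_def] at *
    rcases hsw j with h1 | h1 | h1 <;> simp only [h1.1, h1.2] <;> clear hsw hcase <;> omega
  · refine Finset.card_equiv (Equiv.refl _) fun j => ?_
    have hj := hcase j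
    have hji := hval j i
    have hjp := hval j p
    have hjq := hval j q
    clear hval
    simp only [Finset.mem_filter, Finset.mem_univ, true_and, Fin.lt_def, Equiv.refl_apply] at *
    clear hsw
    omega

theorem IsVexillary.exists_childLabels_eq {w : Perm (Fin n)} (hw : IsVexillary w)
    (hd : ¬ IsDominant w) : ∃ v, childLabels w = {v} ∧ IsVexillary v ∧
      codeMultiset v = codeMultiset w := by
  have hpiv := isPivot_index hd
  obtain ⟨i, hi⟩ := hpiv.exists_cover
  have hs := hw.step hpiv hi
  refine ⟨_, ?_, hs.isVexillary hw, ?_⟩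
  · rw [childLabels_of_not_isDominant hd, transitions]
    -- Of two distinct covers, the one further right would have an entry below `w q` by its own
    -- cover condition and above `w q` by `middle_left` for the other.
    have : leftCovers (w * swap (pIndex w hd) (qIndex w hd)) (pIndex w hd) = {i} := by
      ext j
      rw [mem_leftCovers, Finset.mem_singleton]
      refine ⟨fun hj => ?_, fun e => e ▸ hi⟩
      have hs' := hw.step hpiv hj
      rcases lt_trichotomy i j with h | h | h
      · exact absurd (hs.middle_left j h hs'.lt_p) (not_lt.mpr hs'.val_lt_q.le)
      · exact h.symm
      · exact absurd (hs'.middle_left i h hs.lt_p) (not_lt.mpr hs.val_lt_q.le)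
    rw [this, Finset.image_singleton]
  · unfold codeMultiset
    have : lehmerCode (w * swap (pIndex w hd) (qIndex w hd) * swap i (pIndex w hd)) =
        lehmerCode w ∘ swap i (pIndex w hd) := funext hs.lehmerCode_eq
    rw [this, ← Multiset.map_map]
    congr 1
    exact Multiset.map_univ_val_equiv _

theorem IsVexillary.exists_isDominant {w : Perm (Fin n)} (hw : IsVexillary w) :
    ∃ v : Perm (Fin n), IsDominant v ∧ codeMultiset v = codeMultiset w ∧ stanley v = stanley w := by
  induction w using childLabels_induction with
  | dominant w h => exact ⟨w, h, rfl, rfl⟩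
  | step w h ih =>
    obtain ⟨v, h1, h2, h3⟩ := hw.exists_childLabels_eq h
    obtain ⟨u, h4, h5, h6⟩ := ih v (by simp [h1]) h2
    exact ⟨u, h4, h5.trans h3, by rw [h6, stanley_eq_sum_childLabels h, h1, Finset.sum_singleton]⟩

theorem IsGrass.big_of_inv {w : Perm (Fin n)} {r : ℕ} {μ : YoungDiagram} (hw : IsGrass w r μ)
    {x y : Fin n} (hxy : x < y) (h : w y < w x) : (w y : ℕ) < r ∧ r ≤ w x := by
  have e1 := hw.symm_val (w x)
  have e2 := hw.symm_val (w y)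
  rw [symm_apply_apply] at e1 e2
  rw [Fin.lt_def] at hxy h
  generalize ((w x : Fin n) : ℕ) = a at *
  generalize ((w y : Fin n) : ℕ) = b at *
  have hrow := rowLen_le_of_box fun i j hij => (hw.mem_box i j hij).1
  simp only [grassPos] at e1 e2
  have h3 := hrow (a - r)
  have h4 := hrow (b - r)
  split_ifs at e1 e2 with c1 c2 c2
  · have := μ.colLen_anti (r - 1 - a) (r - 1 - b) (by omega)
    omega
  · omega
  · omega
  · have := μ.rowLen_anti (b - r) (a - r) (by omega)
    omega

/-- Every inversion consists of a value at least `r` followed by a value below `r`. In a 2143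
pattern this makes the `2` at least `r` and the `3` below `r`, a contradiction. -/
theorem IsGrass.isVexillary {w : Perm (Fin n)} {r : ℕ} {μ : YoungDiagram} (hw : IsGrass w r μ) :
    IsVexillary w := by
  intro a b c d hab _ hcd hba had hdc
  have h1 := hw.big_of_inv hab hba
  have h2 := hw.big_of_inv hcd hdc
  rw [Fin.lt_def] at had
  omega

theorem lehmerCode_symm_apply (w : Perm (Fin n)) (v : Fin n) :
    lehmerCode w (w.symm v) =
      (Finset.univ.filter fun u : Fin n => u < v ∧ w.symm v < w.symm u).card := by
  unfold lehmerCode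
  refine Finset.card_equiv w fun j => ?_
  simp [and_comm]

theorem IsGrass.lehmerCode_symm_apply {w : Perm (Fin n)} {r : ℕ} {μ : YoungDiagram}
    (hw : IsGrass w r μ) (v : Fin n) :
    lehmerCode w (w.symm v) = if (v : ℕ) < r then 0 else μ.rowLen (v - r) := by
  rw [ModifiedLS.lehmerCode_symm_apply]
  have key : ∀ u : Fin n, u < v ∧ w.symm v < w.symm u →
      (u : ℕ) < r ∧ r ≤ v := fun u hu => by
    have := hw.big_of_inv hu.2 (by simpa using hu.1)
    simpa using this
  split_ifs with h
  · rw [Finset.card_eq_zero, Finset.filter_eq_empty_iff]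
    intro u _ hu
    have := key u hu
    omega
  · have hrow := rowLen_le_of_box fun i j hij => (hw.mem_box i j hij).1
    have hle := hw.le
    have hv := v.2
    have h3 := hrow (v - r)
    have e1 := hw.symm_val v
    rw [grassPos, if_neg h] at e1
    conv_rhs => rw [← Finset.card_range (μ.rowLen (v - r))]
    -- The smaller values to the right of the value `v` correspond to the columns met by row `v -
    -- r`, the value `u` giving column `r - 1 - u`.
    refine Finset.card_bij' (fun u _ => r - 1 - (u : ℕ))
      (fun j hj => ⟨r - 1 - j, by have := Finset.mem_range.mp hj; omega⟩) ?_ ?_ ?_ ?_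
    · intro u hu
      rw [Finset.mem_filter] at hu
      have h4 := key u hu.2
      have e2 := hw.symm_val u
      rw [grassPos, if_pos h4.1] at e2
      rw [Finset.mem_range, ← YoungDiagram.mem_iff_lt_rowLen]
      by_contra hm
      have := rowLen_add_colLen_of_notMem hm
      have := hu.2.2
      rw [Fin.lt_def] at this
      omega
    · intro j hj
      rw [Finset.mem_range] at hj
      have hm := rowLen_add_colLen_of_mem (YoungDiagram.mem_iff_lt_rowLen.mpr hj)
      have e2 := hw.symm_val ⟨r - 1 - j, by omega⟩
      rw [grassPos, if_pos (by simp; omega)] at e2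
      simp only [show r - 1 - (r - 1 - j) = j by omega] at e2
      simp only [Finset.mem_filter, Finset.mem_univ, true_and, Fin.lt_def]
      constructor <;> omega
    · intro u hu
      have := key u (Finset.mem_filter.mp hu).2
      exact Fin.ext (by simp; omega)
    · intro j hj
      rw [Finset.mem_range] at hj
      simp only
      omega

theorem IsGrass.codeMultiset_eq {w : Perm (Fin n)} {r : ℕ} {μ : YoungDiagram}
    (hw : IsGrass w r μ) : codeMultiset w =
      Finset.univ.val.map fun v : Fin n => if (v : ℕ) < r then 0 else μ.rowLen (v - r) := by
  have h : (fun v : Fin n => if (v : ℕ) < r then 0 else μ.rowLen (v - r)) =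
      lehmerCode w ∘ w.symm := funext fun v => (hw.lehmerCode_symm_apply v).symm
  rw [h, codeMultiset, ← Multiset.map_map]
  congr 1
  exact (Multiset.map_univ_val_equiv w.symm).symm

/-! ### Dominant permutations -/

theorem IsDominant.lehmerCode_antitone {w : Perm (Fin n)} (hw : IsDominant w) :
    Antitone (lehmerCode w) := by
  intro i j hij
  rcases hij.eq_or_lt with rfl | hij
  · exact le_rfl
  refine Finset.card_le_card fun l hl => ?_
  simp only [Finset.mem_filter, Finset.mem_univ, true_and] at hl ⊢
  refine ⟨hij.trans hl.1, ?_⟩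
  by_contra h
  exact hw ⟨i, j, l, hij, hl.1,
    lt_of_le_of_ne (not_lt.mp h) (w.injective.ne (hij.trans hl.1).ne), hl.2⟩

theorem lehmerCode_lt (w : Perm (Fin n)) (i : Fin n) : lehmerCode w i < n := by
  have : lehmerCode w i < (Finset.univ : Finset (Fin n)).card :=
    Finset.card_lt_card (Finset.filter_ssubset.mpr ⟨i, Finset.mem_univ _, by simp⟩)
  simpa using this

theorem IsDominant.exists_hasLehmerCode {w : Perm (Fin n)} (hw : IsDominant w) :
    ∃ μ, HasLehmerCode w μ := by
  have hs : (List.ofFn (lehmerCode w)).SortedGE := by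
    rw [List.sortedGE_iff_pairwise, List.pairwise_ofFn]
    exact fun i j hij => hw.lehmerCode_antitone hij.le
  refine ⟨YoungDiagram.ofRowLens _ hs, fun i => eq_of_forall_lt_iff fun k => ?_⟩
  rw [← YoungDiagram.mem_iff_lt_rowLen, YoungDiagram.mem_ofRowLens]
  simp only [List.length_ofFn, List.getElem_ofFn]
  split_ifs with h <;> simp [h]

theorem youngDiagram_eq_of_rowLen {μ ν : YoungDiagram} (h : ∀ i, μ.rowLen i = ν.rowLen i) :
    μ = ν := by
  ext ⟨i, j⟩
  rw [YoungDiagram.mem_cells, YoungDiagram.mem_cells, YoungDiagram.mem_iff_lt_rowLen,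
    YoungDiagram.mem_iff_lt_rowLen, h]

theorem HasLehmerCode.unique {w : Perm (Fin n)} {μ ν : YoungDiagram} (h : HasLehmerCode w μ)
    (h' : HasLehmerCode w ν) : μ = ν :=
  youngDiagram_eq_of_rowLen fun i => (h i).trans (h' i).symm

theorem eq_of_antitone_of_map_eq {f g : Fin n → ℕ} (hf : Antitone f) (hg : Antitone g)
    (h : Finset.univ.val.map f = Finset.univ.val.map g) : f = g := by
  have hp : (List.ofFn f).Perm (List.ofFn g) := by
    rw [← Multiset.coe_eq_coe]
    simpa [Fin.univ_val_map] using h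
  apply List.ofFn_injective
  refine hp.eq_of_pairwise (le := fun a b => b ≤ a) (fun a b _ _ h1 h2 => le_antisymm h2 h1) ?_ ?_
  · exact List.pairwise_ofFn.mpr fun i j hij => hf hij.le
  · exact List.pairwise_ofFn.mpr fun i j hij => hg hij.le

/-- The code in position `i` counts the values below the entry that have not occurred before
position `i`. The permutations agree before `i`, so the first count is over a subset of the second,
which also contains `v i`. -/
theorem lehmerCode_lt_of_forall_lt {v w : Perm (Fin n)} {i : Fin n} (h : ∀ j < i, v j = w j)
    (hi : v i < w i) : lehmerCode v i < lehmerCode w i := by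
  have h1 := lehmerCode_symm_apply w (w i)
  have h2 := lehmerCode_symm_apply v (v i)
  rw [symm_apply_apply] at h1 h2
  have hsub : ∀ u, i < v.symm u → ¬ w.symm u < i := fun u hu hlt => by
    have := h _ hlt
    rw [apply_symm_apply] at this
    rw [← this, symm_apply_apply] at hu
    exact absurd hu (not_lt.mpr hlt.le)
  rw [h1, h2]
  refine Finset.card_lt_card ⟨fun u hu => ?_, fun hsup => ?_⟩
  · simp only [Finset.mem_filter, Finset.mem_univ, true_and] at hu ⊢
    refine ⟨hu.1.trans hi, lt_of_le_of_ne (not_lt.mp (hsub u hu.2)) ?_⟩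
    rintro rfl
    rw [apply_symm_apply] at hi
    exact absurd hu.1 (not_lt.mpr hi.le)
  · have hm : v i ∈ Finset.univ.filter fun u => u < w i ∧ i < w.symm u := by
      simp only [Finset.mem_filter, Finset.mem_univ, true_and]
      refine ⟨hi, lt_of_not_ge fun hle => ?_⟩
      rcases hle.eq_or_lt with e | hlt
      · rw [symm_apply_eq] at e
        exact hi.ne e
      · have := h _ hlt
        rw [apply_symm_apply] at this
        exact hlt.ne (v.injective this)
    have := hsup hm
    simp at this

theorem lehmerCode_injective : Function.Injective (lehmerCode (n := n)) := by
  intro v w h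
  by_contra hne
  have hex : ∃ i, v i ≠ w i := by
    by_contra! hall
    exact hne (Equiv.ext hall)
  obtain ⟨i, hi, hmin⟩ := WellFounded.has_min (wellFounded_lt (α := Fin n)) {i | v i ≠ w i} hex
  have heq : ∀ j < i, v j = w j := fun j hj => by
    by_contra hj'
    exact hmin j hj' hj
  rcases lt_or_gt_of_ne hi with h1 | h1
  · exact (lehmerCode_lt_of_forall_lt heq h1).ne (congrFun h i)
  · exact (lehmerCode_lt_of_forall_lt (fun j hj => (heq j hj).symm) h1).ne (congrFun h i).symm

/-! ### Extension by fixed points and the Stanley function of a dominant permutation -/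

/-- `v` is the permutation of a larger set that extends `w` by fixed points. -/
def IsExtension {N : ℕ} (v : Perm (Fin N)) (w : Perm (Fin n)) : Prop :=
  n ≤ N ∧ ∀ x : Fin N, (v x : ℕ) = if h : (x : ℕ) < n then (w ⟨x, h⟩ : ℕ) else x

theorem exists_isExtension (w : Perm (Fin n)) (m : ℕ) :
    ∃ v : Perm (Fin (n + m)), IsExtension v w := by
  refine ⟨finSumFinEquiv.permCongr (Equiv.sumCongr w (Equiv.refl (Fin m))), by omega, fun x => ?_⟩
  refine Fin.addCases (fun i => ?_) (fun i => ?_) x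
  · simp [Equiv.permCongr_apply]
  · simp [Equiv.permCongr_apply]

theorem IsExtension.castLE {N : ℕ} {v : Perm (Fin N)} {w : Perm (Fin n)} (h : IsExtension v w)
    (x : Fin n) : (v (Fin.castLE h.1 x) : ℕ) = w x := by
  rw [h.2]; simp

theorem IsExtension.leftDescent_iff {N : ℕ} {v : Perm (Fin N)} {w : Perm (Fin n)}
    (h : IsExtension v w) (a : ℕ) : LeftDescent v a ↔ LeftDescent w a := by
  rw [ModifiedLS.leftDescent_iff, ModifiedLS.leftDescent_iff]
  constructor
  · rintro ⟨i, j, hij, hi, hj⟩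
    rw [Fin.lt_def] at hij
    have h1 := h.2 i
    have h2 := h.2 j
    split_ifs at h1 h2 with c1 c2 c2
    · exact ⟨⟨i, c1⟩, ⟨j, c2⟩, hij, h1 ▸ hi, h2 ▸ hj⟩
    · have := (w ⟨i, c1⟩).2; omega
    · omega
    · omega
  · rintro ⟨i, j, hij, hi, hj⟩
    exact ⟨Fin.castLE h.1 i, Fin.castLE h.1 j, hij, by rw [h.castLE, hi], by rw [h.castLE, hj]⟩

theorem IsExtension.redPoly_eq {N : ℕ} {v : Perm (Fin N)} {w : Perm (Fin n)}
    (h : IsExtension v w) (P : List (ℕ × ℕ)) : redPoly P v = redPoly P w := by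
  induction P generalizing v w with
  | nil =>
    rw [redPoly, redPoly]
    refine if_congr ⟨?_, ?_⟩ rfl rfl
    · rintro rfl
      ext x
      rw [← h.castLE]; simp
    · rintro rfl
      ext x
      rw [h.2]; simp
  | cons x P ih =>
    rw [redPoly, redPoly, ih h]
    congr 2
    unfold leftOp
    by_cases hd : LeftDescent w x.1
    swap
    · rw [if_neg hd, if_neg (mt (h.leftDescent_iff _).mp hd)]
    rw [if_pos hd, if_pos ((h.leftDescent_iff _).mpr hd)]
    refine ih ⟨h.1, fun y => ?_⟩
    have h1 : x.1 + 1 < n := hd.1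
    have hN := h.1
    rw [Perm.mul_apply, val_adjSwap (by omega), h.2]
    by_cases hy : (y : ℕ) < n
    · simp only [dif_pos hy, Perm.mul_apply, val_adjSwap h1]
    · simp only [dif_neg hy]
      rw [if_neg (by omega), if_neg (by omega)]

theorem IsExtension.stanley_eq {N : ℕ} {v : Perm (Fin N)} {w : Perm (Fin n)}
    (h : IsExtension v w) : stanley v = stanley w := by
  have hN := h.1
  funext d
  obtain ⟨m, hm⟩ := exists_bound d
  rw [stanley_apply v le_rfl d hm, stanley_apply (N := N - 1) w (by omega) d hm, h.redPoly_eq]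

theorem IsExtension.lehmerCode_eq {N : ℕ} {v : Perm (Fin N)} {w : Perm (Fin n)}
    (h : IsExtension v w) (x : Fin N) :
    lehmerCode v x = if hx : (x : ℕ) < n then lehmerCode w ⟨x, hx⟩ else 0 := by
  have hge : ∀ j : Fin N, n ≤ j → n ≤ v j := fun j hj => by
    rw [h.2, dif_neg (not_lt.mpr hj)]; exact hj
  split_ifs with hx
  · have hvx : (v x : ℕ) = w ⟨x, hx⟩ := by rw [h.2, dif_pos hx]
    unfold lehmerCode
    symm
    refine Finset.card_bij (fun j _ => Fin.castLE h.1 j) ?_ ?_ ?_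
    · intro j hj
      simp only [Finset.mem_filter, Finset.mem_univ, true_and, Fin.lt_def] at hj ⊢
      rw [h.castLE, hvx]
      exact hj
    · intro j _ k _ hjk
      exact Fin.castLE_injective h.1 hjk
    · intro j hj
      simp only [Finset.mem_filter, Finset.mem_univ, true_and, Fin.lt_def] at hj
      have hjn : (j : ℕ) < n := by
        by_contra hjn
        have := hge j (by omega)
        have := (w ⟨x, hx⟩).2
        omega
      refine ⟨⟨j, hjn⟩, ?_, rfl⟩
      simp only [Finset.mem_filter, Finset.mem_univ, true_and, Fin.lt_def]
      rw [← hvx, ← h.castLE]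
      exact hj
  · rw [lehmerCode, Finset.card_eq_zero, Finset.filter_eq_empty_iff]
    rintro j - ⟨h1, h2⟩
    rw [Fin.lt_def, h.2, h.2, dif_neg hx] at *
    split_ifs at h2 <;> omega

theorem stanley_eq_schur_of_hasLehmerCode {w : Perm (Fin n)} {μ : YoungDiagram}
    (h : HasLehmerCode w μ) : stanley w = schur μ := by
  have hbox : ∀ i j, (i, j) ∈ μ → j < n ∧ i < n := fun i j hij => by
    rw [YoungDiagram.mem_iff_lt_rowLen, h i] at hij
    split_ifs at hij with hi
    · exact ⟨hij.trans (lehmerCode_lt _ _), hi⟩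
    · omega
  -- The shape fits into an `n × n` box, so the inverse Grassmannian permutation lives on `n + n`
  -- points; `w` is extended by `n` fixed points to be comparable with the leaf below it.
  obtain ⟨g, hg⟩ := exists_isGrass hbox
  obtain ⟨v, hv, hcode, hst⟩ := hg.isVexillary.exists_isDominant
  obtain ⟨w', hw'⟩ := exists_isExtension w n
  have hrow : ∀ i, n ≤ i → μ.rowLen i = 0 := fun i hi => by
    rw [h i, dif_neg (not_lt.mpr hi)]
  have hvμ : lehmerCode v = fun x : Fin (n + n) => μ.rowLen x := by
    refine eq_of_antitone_of_map_eq hv.lehmerCode_antitone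
      (fun x y hxy => μ.rowLen_anti _ _ hxy) ?_
    rw [← codeMultiset, hcode, hg.codeMultiset_eq]
    -- The code of `g`, listed by values, is `n` zeros followed by the first `n` row lengths.
    -- Interchanging the two halves gives the row lengths of `μ`, as those from index `n` on vanish.
    have e : (fun x : Fin (n + n) => μ.rowLen x) =
        (fun v : Fin (n + n) => if (v : ℕ) < n then 0 else μ.rowLen (v - n)) ∘ finAddFlip := by
      funext x
      refine Fin.addCases (fun i => ?_) (fun i => ?_) x
      · simp
      · simp only [Function.comp_apply, finAddFlip_apply_natAdd, Fin.val_castAdd, Fin.val_natAdd,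
          i.2, if_true]
        exact hrow _ (Nat.le_add_right _ _)
    rw [e, ← Multiset.map_map]
    congr 1
    exact (Multiset.map_univ_val_equiv _).symm
  have hw'v : w' = v := by
    refine lehmerCode_injective ?_
    rw [hvμ]
    funext x
    rw [hw'.lehmerCode_eq, h x]
  rw [← hw'.stanley_eq, hw'v, hst, hg.stanley_eq]

/-! ### Linear independence of the Schur functions -/

/-- The number of cells in the first `r` rows. -/
def rowSum (μ : YoungDiagram) (r : ℕ) : ℕ :=
  (μ.cells.filter fun x => x.1 < r).card

theorem rowSum_succ (μ : YoungDiagram) (r : ℕ) : rowSum μ (r + 1) = rowSum μ r + μ.rowLen r := by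
  unfold rowSum
  rw [YoungDiagram.rowLen_eq_card, YoungDiagram.row, ← Finset.card_union_of_disjoint,
    ← Finset.filter_or]
  · simp only [Nat.lt_succ_iff_lt_or_eq]
  · rw [Finset.disjoint_filter]
    intro x _ h1 h2
    omega

theorem rowSum_injective : Function.Injective rowSum := fun μ ν h => by
  refine youngDiagram_eq_of_rowLen fun i => ?_
  have h1 := rowSum_succ μ i
  have h2 := rowSum_succ ν i
  rw [h] at h1
  omega

theorem le_apply {μ : YoungDiagram} (T : SemistandardYoungTableau μ) {i j : ℕ} (h : (i, j) ∈ μ) :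
    i ≤ T i j := by
  induction i with
  | zero => exact Nat.zero_le _
  | succ i ih =>
    have := ih (μ.up_left_mem (Nat.le_succ i) le_rfl h)
    have := T.col_strict (show i < i + 1 by omega) h
    omega

theorem sum_range_content {μ : YoungDiagram} (T : SemistandardYoungTableau μ) (r : ℕ) :
    ∑ b ∈ Finset.range r, content T b = (μ.cells.filter fun x => T x.1 x.2 < r).card := by
  unfold content
  simp only [Finsupp.finsetSum_apply]
  rw [Finset.sum_comm, Finset.card_filter]
  refine Finset.sum_congr rfl fun x _ => ?_
  simp [Finsupp.single_apply]

theorem sum_range_content_highestWeight (μ : YoungDiagram) (r : ℕ) :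
    ∑ b ∈ Finset.range r, content (SemistandardYoungTableau.highestWeight μ) b = rowSum μ r := by
  rw [sum_range_content, rowSum]
  congr 1
  refine Finset.filter_congr fun x hx => ?_
  rw [SemistandardYoungTableau.highestWeight_apply, if_pos ((YoungDiagram.mem_cells _).mp hx)]

theorem filter_apply_lt_subset {μ : YoungDiagram} (T : SemistandardYoungTableau μ) (r : ℕ) :
    (μ.cells.filter fun x => T x.1 x.2 < r) ⊆ μ.cells.filter fun x => x.1 < r := fun x hx => by
  rw [Finset.mem_filter] at hx ⊢
  exact ⟨hx.1, (le_apply T ((YoungDiagram.mem_cells _).mp hx.1)).trans_lt hx.2⟩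

/-- Columns increase strictly, so entries below `r` occur only in the first `r` rows; this is
dominance of `ν` over `μ`. -/
theorem rowSum_le_of_content_eq {μ ν : YoungDiagram} {T : SemistandardYoungTableau ν}
    (h : content T = content (SemistandardYoungTableau.highestWeight μ)) :
    rowSum μ ≤ rowSum ν := fun r => by
  rw [← sum_range_content_highestWeight, ← h, sum_range_content]
  exact Finset.card_le_card (filter_apply_lt_subset T r)

/-- Equality of the counts forces all cells of the first `i + 1` rows to have entries at most `i`,
while an entry of row `i` is at least `i`. -/
theorem eq_highestWeight_of_content_eq {μ : YoungDiagram} {T : SemistandardYoungTableau μ}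
    (h : content T = content (SemistandardYoungTableau.highestWeight μ)) :
    T = SemistandardYoungTableau.highestWeight μ := by
  ext i j
  rw [SemistandardYoungTableau.highestWeight_apply]
  split_ifs with hij
  · have h1 : (μ.cells.filter fun x => T x.1 x.2 < i + 1) = μ.cells.filter fun x => x.1 < i + 1 := by
      refine Finset.eq_of_subset_of_card_le (filter_apply_lt_subset T _) ?_
      rw [← sum_range_content, h, sum_range_content_highestWeight, rowSum]
    have h2 : (i, j) ∈ μ.cells.filter fun x => x.1 < i + 1 :=
      Finset.mem_filter.mpr ⟨(YoungDiagram.mem_cells _).mpr hij, Nat.lt_succ_self i⟩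
    rw [← h1, Finset.mem_filter] at h2
    have := le_apply T hij
    have : T i j < i + 1 := h2.2
    omega
  · exact T.zeros hij

theorem schur_apply_content (μ : YoungDiagram) :
    schur μ (content (SemistandardYoungTableau.highestWeight μ)) = 1 := by
  have : {T : SemistandardYoungTableau μ | ∑ x ∈ μ.cells, Finsupp.single (T x.1 x.2) 1 =
      content (SemistandardYoungTableau.highestWeight μ)} =
      {SemistandardYoungTableau.highestWeight μ} :=
    Set.eq_singleton_iff_unique_mem.mpr ⟨rfl, fun T hT => eq_highestWeight_of_content_eq hT⟩
  rw [schur, this, Set.ncard_singleton, Nat.cast_one]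

theorem schur_apply_content_of_not_le {μ ν : YoungDiagram} (h : ¬ rowSum μ ≤ rowSum ν) :
    schur ν (content (SemistandardYoungTableau.highestWeight μ)) = 0 := by
  have : {T : SemistandardYoungTableau ν | ∑ x ∈ ν.cells, Finsupp.single (T x.1 x.2) 1 =
      content (SemistandardYoungTableau.highestWeight μ)} = ∅ :=
    Set.eq_empty_of_forall_notMem fun T hT => h (rowSum_le_of_content_eq hT)
  rw [schur, this, Set.ncard_empty, Nat.cast_zero]

theorem linearIndependent_schur : LinearIndependent ℤ schur := by
  rw [linearIndependent_iff]
  intro c hc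
  by_contra hne
  -- At the weight of a dominance-maximal `μ` in the support, `s_μ` has coefficient one and every
  -- other `s_ν` of the support has coefficient zero.
  obtain ⟨μ, hμ, hmax⟩ := Finset.exists_maximalFor rowSum c.support
    (Finsupp.support_nonempty_iff.mpr hne)
  have h0 := congrArg
    (MvPowerSeries.coeff (content (SemistandardYoungTableau.highestWeight μ))) hc
  rw [Finsupp.linearCombination_apply, Finsupp.sum, map_sum, map_zero,
    Finset.sum_eq_single_of_mem μ hμ] at h0
  · have h1 : c μ * schur μ (content (SemistandardYoungTableau.highestWeight μ)) = 0 := h0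
    rw [schur_apply_content, mul_one] at h1
    exact Finsupp.mem_support_iff.mp hμ h1
  · intro ν hν hνμ
    change c ν * schur ν _ = 0
    rw [schur_apply_content_of_not_le, mul_zero]
    exact fun hle => hνμ (rowSum_injective (le_antisymm (hmax hν hle) hle))

/-! ### Edelman–Greene coefficients -/

open Classical in
/-- The partition that is the Lehmer code of a dominant permutation. -/
noncomputable def codeShape (w : Perm (Fin n)) : YoungDiagram :=
  if h : ∃ μ, HasLehmerCode w μ then h.choose else ⊥

theorem IsDominant.hasLehmerCode {w : Perm (Fin n)} (hw : IsDominant w) :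
    HasLehmerCode w (codeShape w) := by
  have h := hw.exists_hasLehmerCode
  rw [codeShape, dif_pos h]
  exact h.choose_spec

/-- The sum of the basis vectors of the codes of the leaves of the modified LS-tree. -/
noncomputable def leafCoeff (w : Perm (Fin n)) : YoungDiagram →₀ ℤ :=
  ((modifiedLSTree w).leaves.map fun v => Finsupp.single (codeShape v) 1).sum

theorem leafCoeff_apply (w : Perm (Fin n)) (μ : YoungDiagram) :
    leafCoeff w μ = (leafCount w μ : ℤ) := by
  classical
  have hdom := isDominant_of_mem_leaves w
  unfold leafCoeff leafCount
  generalize (modifiedLSTree w).leaves = S at *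
  induction S using Multiset.induction with
  | empty => simp
  | cons v S ih =>
    have hv := hdom v (Multiset.mem_cons_self _ _)
    have h1 : (IsDominant v ∧ HasLehmerCode v μ) ↔ codeShape v = μ :=
      ⟨fun h => hv.hasLehmerCode.unique h.2, fun h => ⟨hv, h ▸ hv.hasLehmerCode⟩⟩
    rw [Multiset.map_cons, Multiset.sum_cons, Finsupp.add_apply,
      ih fun u hu => hdom u (Multiset.mem_cons_of_mem hu), Multiset.countP_cons,
      if_congr h1 rfl rfl, Finsupp.single_apply]
    push_cast
    ring

theorem isEdelmanGreeneCoeff_iff (w : Perm (Fin n)) (c : YoungDiagram →₀ ℤ) :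
    IsEdelmanGreeneCoeff w c ↔ Finsupp.linearCombination ℤ schur c = stanley w := by
  rw [IsEdelmanGreeneCoeff, Finsupp.linearCombination_apply, eq_comm]

theorem isEdelmanGreeneCoeff_leafCoeff (w : Perm (Fin n)) :
    IsEdelmanGreeneCoeff w (leafCoeff w) := by
  rw [isEdelmanGreeneCoeff_iff, leafCoeff, map_multiset_sum, Multiset.map_map,
    stanley_eq_sum_leaves]
  congr 1
  refine Multiset.map_congr rfl fun v hv => ?_
  rw [Function.comp_apply, Finsupp.linearCombination_single, one_smul]
  exact (stanley_eq_schur_of_hasLehmerCode (isDominant_of_mem_leaves w v hv).hasLehmerCode).symm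

theorem IsEdelmanGreeneCoeff.eq_leafCoeff {w : Perm (Fin n)} {c : YoungDiagram →₀ ℤ}
    (h : IsEdelmanGreeneCoeff w c) : c = leafCoeff w := by
  refine linearIndependent_schur ?_
  rw [(isEdelmanGreeneCoeff_iff w c).mp h,
    (isEdelmanGreeneCoeff_iff w _).mp (isEdelmanGreeneCoeff_leafCoeff w)]

end ModifiedLS

theorem mainTheorem5 (n : ℕ) (w : Equiv.Perm (Fin n)) :
    (∀ v ∈ (ModifiedLS.modifiedLSTree w).leaves, ModifiedLS.IsDominant v) ∧
    (∃! c : YoungDiagram →₀ ℤ, ModifiedLS.IsEdelmanGreeneCoeff w c) ∧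
    ∀ c : YoungDiagram →₀ ℤ, ModifiedLS.IsEdelmanGreeneCoeff w c →
      ∀ μ : YoungDiagram, c μ = (ModifiedLS.leafCount w μ : ℤ) :=
  ⟨ModifiedLS.isDominant_of_mem_leaves w,
    ⟨ModifiedLS.leafCoeff w, ModifiedLS.isEdelmanGreeneCoeff_leafCoeff w,
      fun _ hc => hc.eq_leafCoeff⟩,
    fun c hc μ => by rw [hc.eq_leafCoeff, ModifiedLS.leafCoeff_apply]⟩
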